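/- **Setting.** Let $\mathcal S,\mathcal A,\mathcal R$ be finite sets of states, actions and rewards, $S=|\mathcal S|$, $A=|\mathcal A|$. A latent MDP $\theta=(w_m,T_m,R_m)_{m=1}^M$ with horizon $H$ draws a context $m$ with probability $w_m$ at the start of an episode; then $s_1$ is drawn from the initial law $T_m(\cdot\mid\emptyset)$ and, for $t=1,\dots,H$, the reward $r_t\sim R_m(\cdot\mid s_t,a_t)$ and the next state $s_{t+1}\sim T_m(\cdot\mid s_t,a_t)$. Let $\mathcal T=(s_t,a_t,r_t)_{t=1}^H$ be the trajectory, $\mathbb P^\pi_\theta$ its law under a policy $\pi$, and $\mathrm{TV}(P,Q)=\sum_{\mathcal T}|P(\mathcal T)-Q(\mathcal T)|$. Assume $H>2M$ and put $d=2M-1$. A memoryless policy chooses the law of $a_t$ from $(s_t,t)$ only; $\mathrm{Unif}(\mathcal A)$ is the uniformly random policy. Let $\mathrm{SubSeq}(H,d)$ be the set of $\tau=(\tau_1<\dots<\tau_q)$ in $\{1,\dots,H\}$ with $1\le q\le d$. For policies $\boldsymbol\psi=(\psi_0,\dots,\psi_d)$, $\tau\in\mathrm{SubSeq}(H,d)$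 and $z\in\{0,1\}^{q}$, the segmented policy $\nu(\boldsymbol\psi;\tau,z)$ executes $\psi_i$ at the times $t$ with $\tau_i<t\le\tau_{i+1}$ (where $\tau_0=0$, $\tau_{q+1}=H$), except that at each $\tau_i$ with $z_i=1$ the action is uniformly random. **Algorithm (LMDP-OMLE).** Let $\Theta$ be a finite class of latent MDPs with $M$ contexts (on the same spaces and with the same horizon) that contains the true model $\theta^*$, let $K\ge1$ and $n_{\rm test}$ be integers, $\epsilon_{\rm test},\eta>0$, and $\beta=\log(K|\Theta|/\eta)$. For a dataset $\mathcal D$ of executed policies with the trajectories they generated, let $$\mathcal C(\mathcal D)=\Big\{\theta\in\Theta:\ \sum_{(\mathcal T,\pi)\in\mathcal D}\log\mathbb P_\theta^\pi(\mathcal T)\ \ge\ \max_{\theta'\in\Theta}\sum_{(\mathcal T,\pi)\in\mathcal D}\log\mathbb P_{\theta'}^\pi(\mathcal T)-\beta\Big\},\qquad \log 0=-\infty .$$ Put $\Psi^0_{\rm test}=\{\mathrm{Unif}(\mathcal A)\}$, let $\mathcal D^0$ consist of $n_{\rm test}$ episodes of $\mathrm{Unif}(\mathcal A)$ in $\theta^*$,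 and let $\mathcal C^1=\mathcal C(\mathcal D^0)$. For $k=1,2,\dots$, as long as there are a memoryless policy $\pi^k$ and $\theta_1,\theta_2\in\mathcal C^k$ with $\mathrm{TV}(\mathbb P^{\pi^k}_{\theta_1},\mathbb P^{\pi^k}_{\theta_2})>4\epsilon_{\rm test}$: pick such a $\pi^k$ (by any rule, possibly randomized, that uses the past policies and data); put $\Psi^k_{\rm test}=\Psi^{k-1}_{\rm test}\cup\{\pi^k\}$; for every $(\psi_0,\dots,\psi_{d-1})\in(\Psi^k_{\rm test})^d$ with at least one $\psi_i=\pi^k$, every $\tau\in\mathrm{SubSeq}(H,d)$ and every $z\in\{0,1\}^{|\tau|}$, execute $\nu((\psi_0,\dots,\psi_{d-1},\mathrm{Unif}(\mathcal A));\tau,z)$ in $\theta^*$ for $n_{\rm test}$ independent episodes; add all these data to $\mathcal D^{k-1}$ to obtain $\mathcal D^k$, and let $\mathcal C^{k+1}=\mathcal C(\mathcal D^k)$. When there is no such $\pi^k$, stop. **Lemma.** Suppose that $$n_{\rm test}\ \ge\ \frac{3\beta M^2\,(8H^2)^d\,(MS^2A^2)^d}{\epsilon_{\rm test}^2}.$$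 Then with probability at least $1-\eta$, at every iteration $k$ executed by the algorithm there are a context $m$, integers $0\le t_1<t_2\le H$ and states $s,s'$ such that $P_m^{\pi^k}(s_{t_1+1}=s')>0$ and $$P_m^{\pi^k}(s_{t_2}=s\mid s_{t_1}'=s')\ >\ 2\max_{\psi\in\Psi_{\rm test}^{k-1}}P_m^{\psi}(s_{t_2}=s\mid s_{t_1}'=s').$$ Here $P_m^\psi$ is the law under $\psi$ in context $m$ of the true model $\theta^*$, $s'_{t_1}=s_{t_1+1}$, and $P_m^{\psi}(s_{t_2}=s\mid s'_{t_1}=s')$ is the probability of $s_{t_2}=s$ when the process in context $m$ is run with $\psi$ from the state $s'$ at time $t_1+1$. -/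

import Mathlib

open scoped ENNReal BigOperators

/-! ### Latent Markov decision processes -/

/-- A latent MDP with `M` contexts on a state space `S`, action space `A` and reward space `R`.
The context `m` is drawn with probability `w m` at the beginning of an episode.
`T m (some (s, a))` is the law of the next state after the pair `(s, a)` in context `m`, and `T m none`
is the law of the initial state (`none` is the null state-action pair preceding time `1`).
`rew m s a` is the law of the reward. -/
structure LMDP (S A R : Type*) (M : ℕ) where
  w : PMF (Fin M)
  T : Fin M → Option (S × A) → PMF S
  rew : Fin M → S → A → PMF R

/-- A (stochastic, time dependent) memoryless policy for horizon `H`. The index `t : Fin H` stands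
for the time step `t + 1`. -/
abbrev Policy (S A : Type*) (H : ℕ) := Fin H → S → PMF A

/-- A trajectory `(s, a, r)` at the time steps `1, …, H`; the index `t : Fin H` stands for the time
step `t + 1`. -/
abbrev Trajectory (S A R : Type*) (H : ℕ) := Fin H → S × A × R

/-- The entry of `x` just before index `t`, and `o` before the first one. -/
def prevEntry {X : Type*} {n : ℕ} (o : Option X) (x : Fin n → X) (t : Fin n) : Option X :=
  if h : (t : ℕ) = 0 then o else some (x ⟨t - 1, by omega⟩)

/-- Products of Markov transition probabilities sum to one. -/
theorem sum_prod_chain {X : Type*} [Fintype X] : ∀ {n : ℕ} (o : Option X)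
    (f : Fin n → Option X → X → ℝ≥0∞) (_ : ∀ t o, ∑ y, f t o y = 1),
    ∑ x : Fin n → X, ∏ t, f t (prevEntry o x t) (x t) = 1 := by
  intro n
  induction n with
  | zero => intro o f _; simp
  | succ n ih =>
    intro o f hf
    rw [← (Fin.consEquiv (fun _ : Fin (n + 1) => X)).sum_comp, Fintype.sum_prod_type]
    have h : ∀ (y : X) (x : Fin n → X),
        (∏ t, f t (prevEntry o (Fin.cons y x : Fin (n + 1) → X) t)
          ((Fin.cons y x : Fin (n + 1) → X) t))
        = f 0 o y * ∏ t : Fin n, f t.succ (prevEntry (some y) x t) (x t) := by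
      intro y x
      rw [Fin.prod_univ_succ]
      congr 1
      refine Finset.prod_congr rfl fun t _ => ?_
      rw [Fin.cons_succ]
      congr 1
      rcases t with ⟨_ | t, ht⟩
      · simp only [prevEntry, Fin.succ_mk]
        rfl
      · simp only [prevEntry, Fin.succ_mk]
        rfl
    simp only [Fin.consEquiv, Equiv.coe_fn_mk, h]
    simp only [← Finset.mul_sum]
    have h2 : ∀ y : X,
        ∑ x : Fin n → X, ∏ t : Fin n, f t.succ (prevEntry (some y) x t) (x t) = 1 :=
      fun y => ih (some y) (fun t => f t.succ) (fun t o => hf _ _)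
    simp [h2, hf]

theorem sum_pmf {X : Type*} [Fintype X] (p : PMF X) : ∑ x, p x = 1 := by
  rw [← tsum_fintype (L := .unconditional X)]
  exact p.tsum_coe

section Model

variable {S A R : Type*} [Fintype S] [Fintype A] [Fintype R] {M H : ℕ}

/-- The probability `P_m^π (s_t, a_t, r_t | s_{t-1}, a_{t-1})` of one step in context `m`. -/
noncomputable def LMDP.stepProb (θ : LMDP S A R M) (m : Fin M) (π : Policy S A H) (t : Fin H)
    (o : Option (S × A × R)) (y : S × A × R) : ℝ≥0∞ :=
  θ.T m (o.map fun z => (z.1, z.2.1)) y.1 * π t y.1 y.2.1 * θ.rew m y.1 y.2.1 y.2.2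

/-- `P_m^π (𝒯)`: the law of the trajectory under the policy `π` in context `m`. -/
noncomputable def LMDP.contextLaw (θ : LMDP S A R M) (m : Fin M) (π : Policy S A H) :
    PMF (Trajectory S A R H) :=
  PMF.ofFintype (fun x => ∏ t, θ.stepProb m π t (prevEntry none x t) (x t))
    (sum_prod_chain none (θ.stepProb m π) fun t o => by
      simp only [LMDP.stepProb, Fintype.sum_prod_type, ← Finset.mul_sum, sum_pmf, mul_one])

/-- `ℙ_θ^π (𝒯)`: the law of the trajectory under the policy `π` in the latent MDP `θ`. -/
noncomputable def LMDP.law (θ : LMDP S A R M) (π : Policy S A H) : PMF (Trajectory S A R H) :=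
  θ.w.bind fun m => θ.contextLaw m π

/-- The law, in context `m` under `π`, of the state `n` steps after the time step `t₁ + 1`, when the
state at time step `t₁ + 1` is `s'`. -/
noncomputable def LMDP.stateFrom (θ : LMDP S A R M) (m : Fin M) (π : Policy S A H) (t₁ : ℕ)
    (s' : S) : ℕ → PMF S
  | 0 => PMF.pure s'
  | n + 1 => (θ.stateFrom m π t₁ s' n).bind fun s =>
      if h : t₁ + n < H then (π ⟨t₁ + n, h⟩ s).bind fun a => θ.T m (some (s, a)) else PMF.pure s

/-- The segment probability `P_m^π (s_{t₂} = s | s'_{t₁} = s')`, for `0 ≤ t₁ < t₂ ≤ H`, where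
`s'_{t₁} = s_{t₁+1}` is the state following time step `t₁` (for `t₁ = 0`, the initial state `s_1`).
For a memoryless policy this is a product of Markov kernels, so that it makes sense also for a
state `s'` that `π` does not visit at time step `t₁ + 1`. -/
noncomputable def LMDP.segProb (θ : LMDP S A R M) (m : Fin M) (π : Policy S A H) (t₁ t₂ : ℕ)
    (s' s : S) : ℝ≥0∞ :=
  θ.stateFrom m π t₁ s' (t₂ - (t₁ + 1)) s

/-- `P_m^π (s_{t+1} = s)`: probability of visiting `s` at time step `t + 1` (index `t`). -/
noncomputable def LMDP.visitProb (θ : LMDP S A R M) (m : Fin M) (π : Policy S A H) (t : Fin H)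
    (s : S) : ℝ≥0∞ :=
  (θ.contextLaw m π).toOuterMeasure {x | (x t).1 = s}

/-- Total variation distance, in the normalization `∑ |p - q|` (without the factor `1/2`). -/
noncomputable def tvDist {X : Type*} [Fintype X] (p q : PMF X) : ℝ :=
  ∑ x, |(p x).toReal - (q x).toReal|

/-! ### Segmented policies -/

/-- The uniformly random policy. -/
noncomputable def unifPolicy [Nonempty A] : Policy S A H := fun _ _ => PMF.uniformOfFintype A

/-- The nonempty increasing sequences `τ` of at most `d` time steps in `1, …, H`, encoded by their
sets of entries. -/
abbrev SubSeq (H d : ℕ) := {τ : Finset (Fin H) // τ.Nonempty ∧ τ.card ≤ d}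

/-- Checkpoints `τ` together with the binary sequence `z` indexed by the checkpoints. -/
abbrev Switching (H d : ℕ) := Σ τ : SubSeq H d, (↥τ.1 → Bool)

/-- The segmented policy `ν(ψ; τ, z)`: the policy `ψ i` is executed at the times `t` with
`τ_i < t ≤ τ_{i+1}`, i.e. with `i` checkpoints before `t`, except that the action at a checkpoint
`t` is uniformly random if its bit in `z` is one. -/
noncomputable def segmented [Nonempty A] {d : ℕ} (ψ : Fin (d + 1) → Policy S A H)
    (c : Switching H d) : Policy S A H := fun t =>
  if ∃ h : t ∈ c.1.1, c.2 ⟨t, h⟩ = true then fun _ => PMF.uniformOfFintype A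
  else ψ ⟨(c.1.1.filter (· < t)).card,
    Nat.lt_succ_of_le ((Finset.card_filter_le _ _).trans c.1.2.2)⟩ t

/-! ### The algorithm -/

/-- A dataset: pairs of an executed policy and the trajectory it generated. -/
abbrev Dataset (S A R : Type*) (H : ℕ) := List (Policy S A H × Trajectory S A R H)

/-- Log-likelihood `∑ log ℙ_θ^π (𝒯)` of a dataset, with `log 0 = -∞`. -/
noncomputable def LMDP.logLik (θ : LMDP S A R M) (D : Dataset S A R H) : EReal :=
  (D.map fun p => ENNReal.log (θ.law p.1 p.2)).sum

/-- The confidence set `{θ ∈ Θ | ∑ log ℙ_θ ≥ max_{θ' ∈ Θ} ∑ log ℙ_θ' - β}`. -/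
def confSet (Θ : Finset (LMDP S A R M)) (β : ℝ) (D : Dataset S A R H) : Set (LMDP S A R M) :=
  {θ | θ ∈ Θ ∧ Θ.sup (fun θ' => θ'.logLik D) - (β : EReal) ≤ θ.logLik D}

/-- State of the algorithm: the test policies `π^1, π^2, …` chosen so far, in this order, and the
data collected so far. -/
structure RunState (S A R : Type*) (H : ℕ) where
  chosen : List (Policy S A H)
  data : Dataset S A R H

/-- While-loop condition for the policy `π`: two models of the confidence set disagree on `π`. -/
def IsDistinguishing (Θ : Finset (LMDP S A R M)) (β ε : ℝ) (σ : RunState S A R H)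
    (π : Policy S A H) : Prop :=
  ∃ θ₁ ∈ confSet Θ β σ.data, ∃ θ₂ ∈ confSet Θ β σ.data, 4 * ε < tvDist (θ₁.law π) (θ₂.law π)

/-- A (possibly randomized) rule by which the algorithm picks, whenever the while-loop condition
holds for some memoryless policy, a policy for which it holds. The pick may depend on everything
the algorithm has seen. -/
def IsSelectionRule (Θ : Finset (LMDP S A R M)) (β ε : ℝ)
    (sel : RunState S A R H → PMF (Policy S A H)) : Prop :=
  ∀ σ, (∃ π, IsDistinguishing Θ β ε σ π) → ∀ π ∈ (sel σ).support, IsDistinguishing Θ β ε σ π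

/-- Execute the listed policies one after the other in the latent MDP `θ`, one independent episode
each, and return the generated data. -/
noncomputable def execute (θ : LMDP S A R M) : List (Policy S A H) → PMF (Dataset S A R H)
  | [] => PMF.pure []
  | π :: l => (θ.law π).bind fun x => (execute θ l).map fun D => (π, x) :: D

open Classical in
/-- The set of test policies `{Unif(A), π^1, …, π^j}` for `l = [π^1, …, π^j]`. -/
noncomputable def testSet [Nonempty A] (l : List (Policy S A H)) : Finset (Policy S A H) :=
  insert unifPolicy l.toFinset

open Classical in
/-- The pairs of `(ψ_0, …, ψ_{d-1}) ∈ Ψ^d` with at least one `ψ_i = π`, and `(τ, z)`. -/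
noncomputable def queries (d : ℕ) (Ψ : Finset (Policy S A H)) (π : Policy S A H) :
    Finset ((Fin d → Policy S A H) × Switching H d) :=
  (Fintype.piFinset fun _ => Ψ).filter (fun ψ => ∃ i, ψ i = π) ×ˢ Finset.univ

/-- The policies executed in one iteration: `ν((ψ_0, …, ψ_{d-1}, Unif(A)); τ, z)`, `n` times for
each of the queries. -/
noncomputable def plan [Nonempty A] (d n : ℕ) (Ψ : Finset (Policy S A H)) (π : Policy S A H) :
    List (Policy S A H) :=
  (queries d Ψ π).toList.flatMap fun q =>
    List.replicate n (segmented (Fin.snoc q.1 unifPolicy) q.2)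

open Classical in
/-- One pass through the while-loop in the true model `θ`; a run whose loop condition fails has
terminated and keeps its state. -/
noncomputable def iterate [Nonempty A] (θ : LMDP S A R M) (Θ : Finset (LMDP S A R M)) (d n : ℕ)
    (β ε : ℝ) (sel : RunState S A R H → PMF (Policy S A H)) (σ : RunState S A R H) :
    PMF (RunState S A R H) :=
  if ∃ π, IsDistinguishing Θ β ε σ π then
    (sel σ).bind fun π =>
      (execute θ (plan d n (testSet (σ.chosen ++ [π])) π)).map fun D =>
        ⟨σ.chosen ++ [π], σ.data ++ D⟩
  else PMF.pure σ

/-- The law of the state of the algorithm, interacting with the true model `θ`, after `N` passes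
through the while-loop (or at termination, if that is earlier). It starts with `n` episodes of the
uniformly random policy. -/
noncomputable def runLaw [Nonempty A] (θ : LMDP S A R M) (Θ : Finset (LMDP S A R M)) (d n : ℕ)
    (β ε : ℝ) (sel : RunState S A R H → PMF (Policy S A H)) : ℕ → PMF (RunState S A R H)
  | 0 => (execute θ (List.replicate n unifPolicy)).map fun D => ⟨[], D⟩
  | N + 1 => (runLaw θ Θ d n β ε sel N).bind (iterate θ Θ d n β ε sel)

/-- Coverage doubling by `π`: for some context `m` and segment `(t₁, t₂, s, s')` which `π` enters
with positive probability, `P_m^π (s_{t₂} = s | s'_{t₁} = s')` is more than twice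
`max_{ψ ∈ Ψ} P_m^ψ (s_{t₂} = s | s'_{t₁} = s')`. -/
def DoublesCoverage (θ : LMDP S A R M) (Ψ : Finset (Policy S A H)) (π : Policy S A H) : Prop :=
  ∃ (m : Fin M) (t₁ : Fin H) (t₂ : ℕ) (s s' : S), (t₁ : ℕ) < t₂ ∧ t₂ ≤ H ∧
    0 < θ.visitProb m π t₁ s' ∧
    2 * Ψ.sup (fun ψ => θ.segProb m ψ t₁ t₂ s' s) < θ.segProb m π t₁ t₂ s' s

end Model

-- Two estimates collide unless the new policy doubles the coverage.
--
-- Statistics. For a model θ let the ratio of a dataset be the product of the square roots of the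
-- likelihood ratios of θ to the true model, each divided by its mean. These ratios have mean at
-- most 1 and stay supermartingales under adaptive choice of policies. While all of them are below
-- e^β, each model of the confidence set satisfies ∑ TV² ≤ 12β over the executed episodes
-- (`sum_tvDist_sq_le_of_mem_confSet`). Summing over Θ and stopping at the first failure bounds the
-- failure probability by e^{-β}|Θ| = η/K (`pmfMean_iterate_le`, `pmfMean_runLaw_le`).
--
-- Off-policy evaluation. If π does not double the coverage of Ψ, then TV² under π is at most a
-- constant times the sum of TV² under the uniform policy and under the segmented policies built
-- from Ψ (`tvDist_sq_le_of_not_doublesCoverage`). Half of TV is the total positive part of a signed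
-- mixture of 2M Markov chains, with positive weights for the true model and negative ones for θ. At
-- every time and state which a positive chain reaches under π, take as gauge the segment
-- probabilities, as a function of the chain, of a policy from Ψ that covers this chain. Carry as
-- much mass as possible from gauge to gauge (`exists_max_scale`). By maximality each residual has
-- one chain fewer, and coverage keeps the carried mass at most 2. The residual is a difference of
-- two terms, and both can be realised by playing the covering policy up to a checkpoint: one with a
-- uniform action there, at importance weight |A|, the other without it and with sign -1. Recursion
-- on the number of chains (`obsMass_le_sum_schedules`) ends with a single chain, whose mass does
-- not depend on the policy; this takes 2M - 1 = d checkpoints. A mixture without positive weights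
-- has no positive part, so coverage is only ever needed in the true model.
--
-- If π is selected, some model of the confidence set is more than 2ε away from the truth under π.
-- Without doubling, the two estimates then contradict the choice of `n`
-- (`doublesCoverage_of_isDistinguishing`).

/-! ### Positive parts of signed mixtures of Markov chains -/

section Observation

variable {S A R J : Type*} [Fintype S] [Fintype A] [Fintype R] [Fintype J]

/-- Nonnegative action weights that sum to one at every time and state. -/
structure IsActionLaw (ν : ℕ → S → A → ℝ) : Prop where
  nonneg : ∀ p s a, 0 ≤ ν p s a
  sum_eq : ∀ p s, ∑ a, ν p s a = 1

/-- Nonnegative step weights that sum to one over the outcomes. -/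
structure IsStepLaw (v : J → ℕ → S → A → R × S → ℝ) : Prop where
  nonneg : ∀ j p s a o, 0 ≤ v j p s a o
  sum_eq : ∀ j p s a, ∑ o, v j p s a o = 1

/-- The total positive part of the signed mixture with weights `c` of the laws of `k` steps from
the state `s` at time `p`. -/
def obsMass (v : J → ℕ → S → A → R × S → ℝ) (ν : ℕ → S → A → ℝ) :
    ℕ → ℕ → (J → ℝ) → S → ℝ
  | 0, _, c, _ => max (∑ j, c j) 0
  | k + 1, p, c, s => ∑ a, ∑ o : R × S,
      obsMass v ν k (p + 1) (fun j => c j * (ν p s a * v j p s a o)) o.2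

open Classical in
/-- The probability of moving from `s'` at time `p` to `s` in `n` steps. -/
noncomputable def segWeight (v : J → ℕ → S → A → R × S → ℝ) (ν : ℕ → S → A → ℝ) :
    ℕ → ℕ → J → S → S → ℝ
  | 0, _, _, s', s => if s = s' then 1 else 0
  | n + 1, p, j, s', s'' => ∑ s, segWeight v ν n p j s' s *
      ∑ a, ∑ r, ν (p + n) s a * v j (p + n) s a (r, s'')

variable {v : J → ℕ → S → A → R × S → ℝ} {ν : ℕ → S → A → ℝ}

theorem obsMass_nonneg : ∀ (k p : ℕ) (c : J → ℝ) (s : S), 0 ≤ obsMass v ν k p c s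
  | 0, _, _, _ => le_max_right _ _
  | k + 1, p, _, _ => Finset.sum_nonneg fun _ _ => Finset.sum_nonneg fun _ _ =>
      obsMass_nonneg k (p + 1) _ _

/-- Subadditivity of x ↦ max x 0, taken at every leaf of the recursion. All later splittings of
mixtures rest on it. -/
theorem obsMass_add_le : ∀ (k p : ℕ) (c c' : J → ℝ) (s : S),
    obsMass v ν k p (fun j => c j + c' j) s ≤ obsMass v ν k p c s + obsMass v ν k p c' s
  | 0, _, c, c', _ => by
    simp only [obsMass, Finset.sum_add_distrib]
    exact max_le (add_le_add (le_max_left _ _) (le_max_left _ _))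
      (add_nonneg (le_max_right _ _) (le_max_right _ _))
  | k + 1, p, c, c', s => by
    simp only [obsMass, ← Finset.sum_add_distrib]
    refine Finset.sum_le_sum fun a _ => Finset.sum_le_sum fun o _ => ?_
    simp only [add_mul]
    exact obsMass_add_le k (p + 1) _ _ _

theorem obsMass_mul : ∀ (k p : ℕ) (x : ℝ) (_ : 0 ≤ x) (c : J → ℝ) (s : S),
    obsMass v ν k p (fun j => x * c j) s = x * obsMass v ν k p c s
  | 0, _, x, hx, c, _ => by
    simp only [obsMass, ← Finset.mul_sum]
    rw [mul_max_of_nonneg _ _ hx, mul_zero]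
  | k + 1, p, x, hx, c, s => by
    simp only [obsMass, Finset.mul_sum]
    refine Finset.sum_congr rfl fun a _ => Finset.sum_congr rfl fun o _ => ?_
    rw [← obsMass_mul k (p + 1) x hx]
    simp only [mul_assoc]

theorem obsMass_zero (k p : ℕ) (s : S) : obsMass v ν k p (fun _ => 0) s = 0 := by
  have h := obsMass_mul (v := v) (ν := ν) k p 0 le_rfl (fun _ => 0) s
  simpa using h

theorem obsMass_sum_le {ι : Type*} (t : Finset ι) (k p : ℕ) (c : ι → J → ℝ) (s : S) :
    obsMass v ν k p (fun j => ∑ i ∈ t, c i j) s ≤ ∑ i ∈ t, obsMass v ν k p (c i) s := by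
  classical
  induction t using Finset.induction_on with
  | empty => simp [obsMass_zero]
  | insert i t hi ih =>
    simp only [Finset.sum_insert hi]
    exact (obsMass_add_le k p _ _ s).trans (by gcongr)

/-- This is the reason why coverage is never needed in the contexts of the competing model. -/
theorem obsMass_eq_zero (hv : IsStepLaw v) (hν : IsActionLaw ν) : ∀ (k p : ℕ) (c : J → ℝ) (s : S),
    (∀ j, c j ≤ 0) → obsMass v ν k p c s = 0
  | 0, _, _, _, h => max_eq_right (Finset.sum_nonpos fun j _ => h j)
  | k + 1, p, _, _, h => Finset.sum_eq_zero fun _ _ => Finset.sum_eq_zero fun _ _ =>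
      obsMass_eq_zero hv hν k (p + 1) _ _ fun j =>
        mul_nonpos_of_nonpos_of_nonneg (h j) (mul_nonneg (hν.nonneg _ _ _) (hv.nonneg _ _ _ _ _))

theorem sum_step (hv : IsStepLaw v) (hν : IsActionLaw ν) (j : J) (p : ℕ) (s : S) :
    ∑ a, ∑ o, ν p s a * v j p s a o = 1 := by
  simp only [← Finset.mul_sum, hv.sum_eq, mul_one, hν.sum_eq]

theorem sum_sum_step (hv : IsStepLaw v) (hν : IsActionLaw ν) (c : J → ℝ) (p : ℕ) (s : S) :
    ∑ a, ∑ o, ∑ j, c j * (ν p s a * v j p s a o) = ∑ j, c j := by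
  have : ∀ a, ∑ o, ∑ j, c j * (ν p s a * v j p s a o)
      = ∑ j, ∑ o, c j * (ν p s a * v j p s a o) := fun a => Finset.sum_comm
  simp only [this]
  rw [Finset.sum_comm]
  refine Finset.sum_congr rfl fun j _ => ?_
  simp only [← Finset.mul_sum]
  have := sum_step hv hν j p s
  simp only [← Finset.mul_sum] at this
  rw [this, mul_one]

/-- A step preserves the total signed mass, and refining by observations can only increase the
positive part. With `obsMass_le` it shows that a mixture with a single nonzero weight has the same
value under all policies. -/
theorem le_obsMass (hv : IsStepLaw v) (hν : IsActionLaw ν) : ∀ (k p : ℕ) (c : J → ℝ) (s : S),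
    max (∑ j, c j) 0 ≤ obsMass v ν k p c s
  | 0, _, _, _ => le_rfl
  | k + 1, p, c, s => by
    refine max_le ?_ (obsMass_nonneg _ _ _ _)
    rw [← sum_sum_step hv hν c p s]
    exact Finset.sum_le_sum fun a _ => Finset.sum_le_sum fun o _ =>
      (le_max_left _ _).trans (le_obsMass hv hν k (p + 1) _ o.2)

theorem obsMass_le (hv : IsStepLaw v) (hν : IsActionLaw ν) : ∀ (k p : ℕ) (c : J → ℝ) (s : S),
    obsMass v ν k p c s ≤ ∑ j, max (c j) 0
  | 0, _, c, _ => max_le (Finset.sum_le_sum fun j _ => le_max_left _ _)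
      (Finset.sum_nonneg fun j _ => le_max_right _ _)
  | k + 1, p, c, s => by
    rw [← sum_sum_step hv hν _ p s]
    refine Finset.sum_le_sum fun a _ => Finset.sum_le_sum fun o _ =>
      (obsMass_le hv hν k (p + 1) _ o.2).trans (Finset.sum_le_sum fun j _ => ?_)
    rw [max_mul_of_nonneg _ _ (mul_nonneg (hν.nonneg _ _ _) (hv.nonneg _ _ _ _ _)), zero_mul]

theorem obsMass_congr {ν' : ℕ → S → A → ℝ} : ∀ (k p : ℕ) (c : J → ℝ) (s : S),
    (∀ q, p ≤ q → q < p + k → ν q = ν' q) → obsMass v ν k p c s = obsMass v ν' k p c s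
  | 0, _, _, _, _ => rfl
  | k + 1, p, c, s, h => by
    simp only [obsMass]
    rw [h p le_rfl (by omega)]
    exact Finset.sum_congr rfl fun a _ => Finset.sum_congr rfl fun o _ =>
      obsMass_congr k (p + 1) _ _ fun q h1 h2 => h q (by omega) (by omega)

theorem segWeight_nonneg (hv : IsStepLaw v) (hν : IsActionLaw ν) : ∀ (n p : ℕ) (j : J) (s' s : S),
    0 ≤ segWeight v ν n p j s' s
  | 0, _, _, s', s => by unfold segWeight; split_ifs <;> norm_num
  | n + 1, p, j, s', s => Finset.sum_nonneg fun s _ => mul_nonneg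
      (segWeight_nonneg hv hν n p j s' s) (Finset.sum_nonneg fun _ _ => Finset.sum_nonneg fun _ _ =>
        mul_nonneg (hν.nonneg _ _ _) (hv.nonneg _ _ _ _ _))

theorem segWeight_congr {ν' : ℕ → S → A → ℝ} : ∀ (n p : ℕ) (j : J) (s' s : S),
    (∀ q, p ≤ q → q < p + n → ν q = ν' q) → segWeight v ν n p j s' s = segWeight v ν' n p j s' s
  | 0, _, _, _, _, _ => rfl
  | n + 1, p, j, s', s, h => by
    simp only [segWeight]
    rw [h (p + n) (by omega) (by omega)]
    exact Finset.sum_congr rfl fun s _ => by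
      rw [segWeight_congr n p j s' s fun q h1 h2 => h q h1 (by omega)]

/-- Forgetting the observations of a segment, except for its end points, loses mass. -/
theorem sum_obsMass_segWeight_le (k p : ℕ) (c : J → ℝ) (s' : S) : ∀ n : ℕ,
    ∑ s, obsMass v ν k (p + n) (fun j => c j * segWeight v ν n p j s' s) s
      ≤ obsMass v ν (n + k) p c s' := by
  intro n
  induction n generalizing k with
  | zero =>
    rw [Finset.sum_eq_single s']
    · simp [segWeight]
    · intro s _ hs
      simp [segWeight, hs, obsMass_zero]
    · simp
  | succ n ih =>
    have h := ih (k + 1)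
    rw [show n + 1 + k = n + (k + 1) by ring]
    refine le_trans ?_ h
    simp only [obsMass, Fintype.sum_prod_type]
    have e : ∀ s'' : S, obsMass v ν k (p + (n + 1))
        (fun j => c j * segWeight v ν (n + 1) p j s' s'') s'' ≤
        ∑ s, ∑ a, ∑ r, obsMass v ν k (p + n + 1) (fun j => c j * segWeight v ν n p j s' s *
          (ν (p + n) s a * v j (p + n) s a (r, s''))) s'' := by
      intro s''
      simp only [segWeight, Finset.mul_sum]
      refine (obsMass_sum_le _ _ _ _ _).trans (Finset.sum_le_sum fun s _ => ?_)
      refine (obsMass_sum_le _ _ _ _ _).trans (Finset.sum_le_sum fun a _ => ?_)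
      refine (obsMass_sum_le _ _ _ _ _).trans (Finset.sum_le_sum fun r _ => ?_)
      simp only [mul_assoc]
      exact le_rfl
    refine (Finset.sum_le_sum fun s'' _ => e s'').trans (le_of_eq ?_)
    rw [Finset.sum_comm]
    refine Finset.sum_congr rfl fun s _ => ?_
    rw [Finset.sum_comm]
    refine Finset.sum_congr rfl fun a _ => ?_
    rw [Finset.sum_comm]

end Observation

/-! ### Carrying mass along a gauge -/

section Telescope

variable {S A R J : Type*} [Fintype S] [Fintype A] [Fintype R] [Fintype J]

/-- Take the smallest quotient `a j / b j` among the indices with `b j > 0`. The index with equality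
is the context that disappears from the residual. -/
theorem exists_max_scale {ι : Type*} (t : Finset ι) (a b : ι → ℝ) (ha : ∀ j ∈ t, 0 ≤ a j)
    (hb : ∀ j ∈ t, 0 ≤ b j) (hpos : ∃ j ∈ t, 0 < b j) :
    ∃ x, 0 ≤ x ∧ (∀ j ∈ t, x * b j ≤ a j) ∧ ∃ j ∈ t, x * b j = a j := by
  classical
  obtain ⟨j₀, hj₀, hbj₀⟩ := hpos
  obtain ⟨j, hj, hmin⟩ := (t.filter fun j => 0 < b j).exists_min_image (fun j => a j / b j)
    ⟨j₀, by simp [hj₀, hbj₀]⟩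
  simp only [Finset.mem_filter] at hj hmin
  refine ⟨a j / b j, div_nonneg (ha j hj.1) hj.2.le, fun i hi => ?_, j, hj.1,
    div_mul_cancel₀ _ hj.2.ne'⟩
  rcases (hb i hi).eq_or_lt with h | h
  · rw [← h, mul_zero]
    exact ha i hi
  · exact (le_div_iff₀ h).1 (hmin i ⟨hi, h⟩)

open Classical in
/-- The mass transported from `s'` in `n` steps by the weights `μ`. -/
noncomputable def transported (μ : ℕ → S → A → R × S → ℝ) (s' : S) : ℕ → S → ℝ
  | 0, s => if s = s' then 1 else 0
  | n + 1, s'' => ∑ s, transported μ s' n s * ∑ a, ∑ r, μ n s a (r, s'')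

theorem transported_nonneg {μ : ℕ → S → A → R × S → ℝ} (hμ : ∀ n s a o, 0 ≤ μ n s a o) (s' : S) :
    ∀ (n : ℕ) (s : S), 0 ≤ transported μ s' n s
  | 0, s => by unfold transported; split_ifs <;> norm_num
  | n + 1, s => Finset.sum_nonneg fun _ _ => mul_nonneg (transported_nonneg hμ s' n _)
      (Finset.sum_nonneg fun _ _ => Finset.sum_nonneg fun _ _ => hμ _ _ _ _)

theorem sum_transported_succ (μ : ℕ → S → A → R × S → ℝ) (s' : S) (n : ℕ) (f : S → ℝ) :
    ∑ s, transported μ s' n s * ∑ a, ∑ o : R × S, μ n s a o * f o.2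
      = ∑ s, transported μ s' (n + 1) s * f s := by
  simp only [transported, Fintype.sum_prod_type, Finset.sum_mul, Finset.mul_sum]
  symm
  rw [Finset.sum_comm]
  refine Finset.sum_congr rfl fun s _ => ?_
  rw [Finset.sum_comm]
  refine Finset.sum_congr rfl fun a _ => ?_
  rw [Finset.sum_comm]
  exact Finset.sum_congr rfl fun r _ => Finset.sum_congr rfl fun s'' _ => by ring

/-- Telescoping over the first step after which the gauge `κ` takes over. -/
theorem obsMass_le_telescope {v : J → ℕ → S → A → R × S → ℝ} {ν : ℕ → S → A → ℝ}
    {μ : ℕ → S → A → R × S → ℝ} (hμ : ∀ n s a o, 0 ≤ μ n s a o)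
    (κ : ℕ → S → J → ℝ) (s' : S) (hκ : ∀ j, κ 0 s' j = 1) (k p : ℕ) (c : J → ℝ) :
    ∀ i ≤ k, obsMass v ν k p c s' ≤
      (∑ i' ∈ Finset.range i, ∑ s, transported μ s' i' s * ∑ a, ∑ o : R × S,
        obsMass v ν (k - i' - 1) (p + i' + 1) (fun j => c j *
          (κ i' s j * (ν (p + i') s a * v j (p + i') s a o) - μ i' s a o * κ (i' + 1) o.2 j)) o.2)
      + ∑ s, transported μ s' i s * obsMass v ν (k - i) (p + i) (fun j => c j * κ i s j) s := by
  intro i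
  induction i with
  | zero =>
    intro _
    rw [Finset.sum_eq_single s']
    · simp [transported, hκ]
    · intro s _ hs
      simp [transported, hs]
    · simp
  | succ i ih =>
    intro hi
    refine (ih (by omega)).trans ?_
    rw [Finset.sum_range_succ, add_assoc]
    refine add_le_add le_rfl ?_
    rw [← sum_transported_succ, ← Finset.sum_add_distrib]
    refine Finset.sum_le_sum fun s _ => ?_
    rw [← mul_add, ← Finset.sum_add_distrib]
    refine mul_le_mul_of_nonneg_left ?_ (transported_nonneg hμ _ _ _)
    obtain ⟨m, hm⟩ : ∃ m, k - i = m + 1 := ⟨k - i - 1, by omega⟩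
    rw [show k - i - 1 = m by omega, show k - (i + 1) = m by omega, hm]
    simp only [obsMass]
    refine Finset.sum_le_sum fun a _ => ?_
    rw [← Finset.sum_add_distrib]
    refine Finset.sum_le_sum fun o _ => ?_
    rw [← obsMass_mul _ _ _ (hμ _ _ _ _)]
    -- The weight κ_i ν v is split into the residual κ_i ν v - μ κ_{i+1} and the carried part μ
    -- κ_{i+1}.
    refine le_trans (le_of_eq ?_) (obsMass_add_le _ _ _ _ _)
    congr 1
    ext j
    ring

end Telescope

/-! ### Schedules of checkpoints and their total weight -/

section Schedule

variable {S A R J Q : Type*} [Fintype S] [Fintype A] [Fintype R] [Fintype J]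

/-- The policy that follows a list of checkpoints `(t, z, ψ)`: up to the checkpoint `t` it follows
`ψ`, except that it follows `u` at the time `t` itself if `z` holds. After the last checkpoint it
follows `u`. -/
def schedulePolicy (act : Q → ℕ → S → A → ℝ) (u : ℕ → S → A → ℝ) :
    List (ℕ × Bool × Q) → ℕ → S → A → ℝ
  | [], q => u q
  | e :: l, q =>
    if q < e.1 then act e.2.2 q
    else if q = e.1 then (if e.2.1 = true then u q else act e.2.2 q)
    else schedulePolicy act u l q

open Classical in
/-- Lists of at most `n` checkpoints in the `k` time steps after `p`, where the policies are taken
from the candidates for the segments between the checkpoints. -/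
noncomputable def schedules (Cand : ℕ → ℕ → Finset Q) : ℕ → ℕ → ℕ → Finset (List (ℕ × Bool × Q))
  | 0, _, _ => {[]}
  | _ + 1, 0, _ => {[]}
  | n + 1, k + 1, p =>
    ((Finset.range (k + 1)).biUnion fun i => (Cand p (p + i)).biUnion fun ψ =>
      (schedules Cand n (k - i) (p + i + 1)).image (List.cons (p + i, true, ψ))) ∪
    ((Finset.range k).biUnion fun i => (Cand p (p + i + 1)).biUnion fun ψ =>
      (schedules Cand n (k - i) (p + i + 1)).image (List.cons (p + i, false, ψ)))

/-- The unions are disjoint, because time, bit and policy of the first checkpoint can be read off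
the list. -/
theorem sum_schedules_succ (Cand : ℕ → ℕ → Finset Q) (n k p : ℕ)
    (F : List (ℕ × Bool × Q) → ℝ) :
    ∑ l ∈ schedules Cand (n + 1) (k + 1) p, F l =
      (∑ i ∈ Finset.range (k + 1), ∑ ψ ∈ Cand p (p + i),
        ∑ l ∈ schedules Cand n (k - i) (p + i + 1), F ((p + i, true, ψ) :: l)) +
      ∑ i ∈ Finset.range k, ∑ ψ ∈ Cand p (p + i + 1),
        ∑ l ∈ schedules Cand n (k - i) (p + i + 1), F ((p + i, false, ψ) :: l) := by
  classical
  rw [schedules, Finset.sum_union]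
  · congr 1
    · rw [Finset.sum_biUnion]
      · refine Finset.sum_congr rfl fun i _ => ?_
        rw [Finset.sum_biUnion]
        · exact Finset.sum_congr rfl fun ψ _ => Finset.sum_image fun _ _ _ _ h => (List.cons.inj h).2
        · intro ψ _ ψ' _ hne
          simp only [Function.onFun, Finset.disjoint_left, Finset.mem_image]
          rintro _ ⟨l, _, rfl⟩ ⟨l', _, h⟩
          simp only [List.cons.injEq, Prod.mk.injEq] at h
          exact hne h.1.2.2.symm
      · intro i _ i' _ hne
        simp only [Function.onFun, Finset.disjoint_left, Finset.mem_biUnion, Finset.mem_image]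
        rintro _ ⟨ψ, _, l, _, rfl⟩ ⟨ψ', _, l', _, h⟩
        simp only [List.cons.injEq, Prod.mk.injEq] at h
        exact hne (by omega)
    · rw [Finset.sum_biUnion]
      · refine Finset.sum_congr rfl fun i _ => ?_
        rw [Finset.sum_biUnion]
        · exact Finset.sum_congr rfl fun ψ _ => Finset.sum_image fun _ _ _ _ h => (List.cons.inj h).2
        · intro ψ _ ψ' _ hne
          simp only [Function.onFun, Finset.disjoint_left, Finset.mem_image]
          rintro _ ⟨l, _, rfl⟩ ⟨l', _, h⟩
          simp only [List.cons.injEq, Prod.mk.injEq] at h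
          exact hne h.1.2.2.symm
      · intro i _ i' _ hne
        simp only [Function.onFun, Finset.disjoint_left, Finset.mem_biUnion, Finset.mem_image]
        rintro _ ⟨ψ, _, l, _, rfl⟩ ⟨ψ', _, l', _, h⟩
        simp only [List.cons.injEq, Prod.mk.injEq] at h
        exact hne (by omega)
  · simp only [Finset.disjoint_left, Finset.mem_biUnion, Finset.mem_image]
    rintro _ ⟨i, _, ψ, _, l, _, rfl⟩ ⟨i', _, ψ', _, l', _, h⟩
    simp at h

theorem schedules_zero_right (Cand : ℕ → ℕ → Finset Q) (n p : ℕ) :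
    schedules Cand n 0 p = {[]} := by
  cases n <;> rfl

/-- The product over the checkpoints of the importance weight `C` or `C * K`. -/
noncomputable def scheduleWeight (C K : ℝ) (l : List (ℕ × Bool × Q)) : ℝ :=
  (l.map fun e => C * if e.2.1 = true then K else 1).prod

/-- The sign `-1` for every checkpoint without a random action. -/
noncomputable def scheduleSign (l : List (ℕ × Bool × Q)) : ℝ :=
  (l.map fun e => if e.2.1 = true then (1 : ℝ) else -1).prod

theorem scheduleWeight_nonneg {C K : ℝ} (hC : 0 ≤ C) (hK : 0 ≤ K) (l : List (ℕ × Bool × Q)) :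
    0 ≤ scheduleWeight C K l := by
  refine List.prod_nonneg fun x hx => ?_
  obtain ⟨e, _, rfl⟩ := List.mem_map.1 hx
  split_ifs <;> positivity

/-- Total weight of the schedules when the weights of one checkpoint sum to at most `B`. -/
theorem sum_schedules_prod_le (Cand : ℕ → ℕ → Finset Q) (g : Bool → Q → ℝ)
    (hg : ∀ b ψ, 0 ≤ g b ψ) {B : ℝ}
    (hB : ∀ p q q', ∑ ψ ∈ Cand p q, g true ψ + ∑ ψ ∈ Cand p q', g false ψ ≤ B) {H : ℕ}
    (hBH : 1 ≤ H * B) : ∀ n k p, k ≤ H →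
    ∑ l ∈ schedules Cand n k p, (l.map fun e => g e.2.1 e.2.2).prod ≤ (H * B) ^ n := by
  intro n
  induction n with
  | zero => intro k p _; simp [schedules]
  | succ n ih =>
    intro k p hk
    cases k with
    | zero =>
      simp only [schedules, Finset.sum_singleton, List.map_nil, List.prod_nil]
      exact one_le_pow₀ hBH
    | succ k =>
      rw [sum_schedules_succ]
      simp only [List.map_cons, List.prod_cons, ← Finset.mul_sum]
      have h0 : (0 : ℝ) ≤ (H * B) ^ n := pow_nonneg (by linarith) _
      have h1 : ∀ i, ∀ q, ∀ b, ∑ ψ ∈ Cand p q, g b ψ *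
          ∑ l ∈ schedules Cand n (k - i) (p + i + 1), (l.map fun e => g e.2.1 e.2.2).prod
          ≤ (∑ ψ ∈ Cand p q, g b ψ) * (H * B) ^ n := by
        intro i q b
        rw [Finset.sum_mul]
        exact Finset.sum_le_sum fun ψ _ =>
          mul_le_mul_of_nonneg_left (ih _ _ (by omega)) (hg _ _)
      -- Adding the term `i = k` lets checkpoints with and without random action range over the same
      -- `k + 1` times.
      have h2 : ∑ i ∈ Finset.range k, ∑ ψ ∈ Cand p (p + i + 1), g false ψ *
          ∑ l ∈ schedules Cand n (k - i) (p + i + 1), (l.map fun e => g e.2.1 e.2.2).prod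
          ≤ ∑ i ∈ Finset.range (k + 1), (∑ ψ ∈ Cand p (p + i + 1), g false ψ) * (H * B) ^ n := by
        rw [Finset.sum_range_succ _ k]
        refine le_add_of_le_of_nonneg (Finset.sum_le_sum fun i _ => h1 i _ _) ?_
        exact mul_nonneg (Finset.sum_nonneg fun _ _ => hg _ _) h0
      refine (add_le_add (Finset.sum_le_sum fun i _ => h1 i (p + i) true) h2).trans ?_
      rw [← Finset.sum_add_distrib]
      have h3 : ∀ i ∈ Finset.range (k + 1), (∑ ψ ∈ Cand p (p + i), g true ψ) * (H * B) ^ n +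
          (∑ ψ ∈ Cand p (p + i + 1), g false ψ) * (H * B) ^ n ≤ B * (H * B) ^ n := by
        intro i _
        rw [← add_mul]
        exact mul_le_mul_of_nonneg_right (hB _ _ _) h0
      refine (Finset.sum_le_sum h3).trans ?_
      rw [Finset.sum_const, Finset.card_range, nsmul_eq_mul, pow_succ']
      have hB0 : 0 ≤ B := by
        refine le_trans ?_ (hB 0 0 0)
        exact add_nonneg (Finset.sum_nonneg fun _ _ => hg _ _) (Finset.sum_nonneg fun _ _ => hg _ _)
      rw [← mul_assoc]
      gcongr

end Schedule

/-! ### Off-policy evaluation by induction on the number of chains -/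

section OffPolicy

variable {S A R J Q : Type*} [Fintype S] [Fintype A] [Fintype R] [Fintype J]

theorem scheduleWeight_cons (C K : ℝ) (e : ℕ × Bool × Q) (l : List (ℕ × Bool × Q)) :
    scheduleWeight C K (e :: l) = (C * if e.2.1 = true then K else 1) * scheduleWeight C K l := by
  simp [scheduleWeight]

theorem scheduleSign_cons (e : ℕ × Bool × Q) (l : List (ℕ × Bool × Q)) :
    scheduleSign (e :: l) = (if e.2.1 = true then (1 : ℝ) else -1) * scheduleSign l := by
  simp [scheduleSign]

variable {v : J → ℕ → S → A → R × S → ℝ} {act : Q → ℕ → S → A → ℝ} {u : ℕ → S → A → ℝ}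

/-- A checkpoint with a random action, followed by the schedule `l`. -/
theorem sum_obsMass_checkpoint_true {K : ℝ} (hK : 0 < K) (hu : ∀ p s a, u p s a = K⁻¹)
    (p k i : ℕ) (hi : i ≤ k) (ψ : Q) (l : List (ℕ × Bool × Q)) (c : J → ℝ) (s' : S) :
    ∑ s, ∑ a, ∑ o : R × S, obsMass v (schedulePolicy act u l) (k - i) (p + i + 1)
      (fun j => c j * (segWeight v (act ψ) i p j s' s * v j (p + i) s a o)) o.2
      ≤ K * obsMass v (schedulePolicy act u ((p + i, true, ψ) :: l)) (k + 1) p c s' := by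
  have h := sum_obsMass_segWeight_le (v := v)
    (ν := schedulePolicy act u ((p + i, true, ψ) :: l)) (k - i + 1) p c s' i
  rw [show i + (k - i + 1) = k + 1 by omega] at h
  refine le_trans ?_ (mul_le_mul_of_nonneg_left h hK.le)
  rw [Finset.mul_sum]
  refine Finset.sum_le_sum fun s _ => ?_
  simp only [obsMass, Finset.mul_sum]
  refine Finset.sum_le_sum fun a _ => Finset.sum_le_sum fun o _ => ?_
  rw [← obsMass_mul _ _ _ hK.le]
  refine le_of_eq ?_
  rw [obsMass_congr (ν' := schedulePolicy act u ((p + i, true, ψ) :: l))]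
  · congr 1
    ext j
    rw [segWeight_congr (ν := act ψ) (ν' := schedulePolicy act u ((p + i, true, ψ) :: l))]
    · have : schedulePolicy act u ((p + i, true, ψ) :: l) (p + i) s a = K⁻¹ := by
        simp [schedulePolicy, hu]
      rw [this]
      field_simp
    · intro q _ hq
      simp [schedulePolicy, hq]
  · intro q hq _
    simp only [schedulePolicy]
    rw [if_neg (by omega), if_neg (by omega)]

/-- A checkpoint without a random action, followed by the schedule `l`. -/
theorem sum_obsMass_checkpoint_false (p k i : ℕ) (hi : i ≤ k) (ψ : Q)
    (l : List (ℕ × Bool × Q)) (c : J → ℝ) (s' : S) :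
    ∑ s, obsMass v (schedulePolicy act u l) (k - i) (p + i + 1)
      (fun j => c j * segWeight v (act ψ) (i + 1) p j s' s) s
      ≤ obsMass v (schedulePolicy act u ((p + i, false, ψ) :: l)) (k + 1) p c s' := by
  have h := sum_obsMass_segWeight_le (v := v)
    (ν := schedulePolicy act u ((p + i, false, ψ) :: l)) (k - i) p c s' (i + 1)
  rw [show i + 1 + (k - i) = k + 1 by omega] at h
  refine le_trans (le_of_eq ?_) h
  refine Finset.sum_congr rfl fun s _ => ?_
  rw [obsMass_congr (ν' := schedulePolicy act u ((p + i, false, ψ) :: l))]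
  · congr 1
    ext j
    rw [segWeight_congr (ν := act ψ) (ν' := schedulePolicy act u ((p + i, false, ψ) :: l))]
    intro q _ hq
    rcases lt_or_eq_of_le (show q ≤ p + i by omega) with h | h <;> simp [schedulePolicy, h]
  · intro q hq _
    simp only [schedulePolicy]
    rw [if_neg (by omega), if_neg (by omega)]

/-- Off-policy evaluation: the positive part of the difference of two mixtures under the policy
`π` is controlled by the differences under the scheduled policies, provided that the candidates
cover the segments which `π` visits in the contexts of positive weight. -/
theorem obsMass_le_sum_schedules (hv : IsStepLaw v) (hact : ∀ ψ, IsActionLaw (act ψ))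
    {K : ℝ} (hK : 0 < K) (hu : IsActionLaw u) (hu' : ∀ p s a, u p s a = K⁻¹)
    {π : ℕ → S → A → ℝ} (hπ : IsActionLaw π) {H : ℕ}
    (pos : J → Prop) (Vis : ℕ → J → S → Prop)
    (hVis : ∀ p j s' n s, pos j → Vis p j s' → p + n < H → 0 < segWeight v π n p j s' s →
      Vis (p + n) j s)
    (Cand : ℕ → ℕ → Finset Q) {C : ℝ} (hC : 0 ≤ C)
    (hcov : ∀ p n j s' s, pos j → p + n < H → Vis p j s' → ∃ ψ ∈ Cand p (p + n),
      segWeight v π n p j s' s ≤ C * segWeight v (act ψ) n p j s' s) :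
    ∀ (n k p : ℕ) (c : J → ℝ) (s' : S), p + k = H → (∀ j, pos j → 0 ≤ c j) →
      (∀ j, ¬ pos j → c j ≤ 0) → (Set.ncard {j | c j ≠ 0} ≤ n + 1) →
      (p < H → ∀ j, pos j → c j ≠ 0 → Vis p j s') →
      obsMass v π k p c s' ≤ ∑ l ∈ schedules Cand n k p, scheduleWeight C K l *
        obsMass v (schedulePolicy act u l) k p (fun j => scheduleSign l * c j) s' := by
  classical
  have hsched : ∀ l : List (ℕ × Bool × Q), IsActionLaw (schedulePolicy act u l) := by
    intro l
    induction l with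
    | nil => exact ⟨fun _ _ _ => hu.nonneg _ _ _, fun _ _ => hu.sum_eq _ _⟩
    | cons e l ih =>
      constructor
      · intro q s a
        simp only [schedulePolicy]
        split_ifs
        exacts [(hact _).nonneg _ _ _, hu.nonneg _ _ _, (hact _).nonneg _ _ _, ih.nonneg _ _ _]
      · intro q s
        simp only [schedulePolicy]
        split_ifs
        exacts [(hact _).sum_eq _ _, hu.sum_eq _ _, (hact _).sum_eq _ _, ih.sum_eq _ _]
  have hrhs : ∀ (n k p : ℕ) (c : J → ℝ) (s' : S), 0 ≤ ∑ l ∈ schedules Cand n k p,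
      scheduleWeight C K l *
        obsMass v (schedulePolicy act u l) k p (fun j => scheduleSign l * c j) s' :=
    fun n k p c s' => Finset.sum_nonneg fun l _ => mul_nonneg
      (scheduleWeight_nonneg hC hK.le l) (obsMass_nonneg _ _ _ _)
  intro n
  induction n with
  | zero =>
    intro k p c s' _ hc1 hc2 hcard _
    -- At most one chain is left, so the policy no longer matters and `π` can be exchanged for the
    -- uniform tail.
    have e : obsMass v π k p c s' ≤ max (∑ j, c j) 0 := by
      refine (obsMass_le hv hπ k p c s').trans ?_
      rcases Set.ncard_le_one_iff_eq (Set.toFinite _) |>.1 hcard with h | ⟨j, h⟩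
      · have : ∀ j, c j = 0 := fun j => by
          by_contra hj
          exact (h ▸ (show j ∈ {j | c j ≠ 0} from hj) : j ∈ (∅ : Set J))
        simp [this]
      · have h0 : ∀ i, i ≠ j → c i = 0 := fun i hi => by
          by_contra hne
          exact hi (h ▸ (show i ∈ {j | c j ≠ 0} from hne) : i ∈ ({j} : Set J))
        rw [Finset.sum_eq_single j, Finset.sum_eq_single j]
        · intro i _ hi; exact h0 i hi
        · simp
        · intro i _ hi; simp [h0 i hi]
        · simp
    refine e.trans ?_
    simp only [schedules, Finset.sum_singleton, scheduleWeight, scheduleSign, List.map_nil,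
      List.prod_nil, one_mul]
    exact le_obsMass hv (hsched []) k p c s'
  | succ n ih =>
    intro k p c s' hpk hc1 hc2 hcard hvis
    cases k with
    | zero =>
      simp [schedules, scheduleWeight, scheduleSign, obsMass]
    | succ k =>
    by_cases hP : ∃ m, pos m ∧ c m ≠ 0
    swap
    · rw [obsMass_eq_zero hv hπ]
      · exact hrhs _ _ _ _ _
      · intro j
        by_cases hj : pos j
        · by_contra h
          exact hP ⟨j, hj, by intro h0; rw [h0] at h; exact h le_rfl⟩
        · exact hc2 j hj
    have hpH : p < H := by omega
    obtain ⟨m₀, hm₀, hcm₀⟩ := hP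
    let live : ℕ → S → Prop := fun i s => ∃ m, pos m ∧ c m ≠ 0 ∧ 0 < segWeight v π i p m s' s
    -- The gauge: the segment probabilities, in all contexts at once, of one candidate that covers a
    -- live positive context. It is zero where no such context is live or the horizon is passed.
    have hκ : ∀ i s, ∃ κ : J → ℝ, (∀ j, 0 ≤ κ j) ∧
        (live i s → i ≤ k → (∃ m, c m ≠ 0 ∧ 0 < segWeight v π i p m s' s ∧
          segWeight v π i p m s' s ≤ C * κ m) ∧
          ∃ ψ ∈ Cand p (p + i), ∀ j, κ j = segWeight v (act ψ) i p j s' s) ∧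
        (¬ (live i s ∧ i ≤ k) → ∀ j, κ j = 0) := by
      intro i s
      by_cases h : live i s ∧ i ≤ k
      · obtain ⟨⟨m, hm, hcm, hseg⟩, hik⟩ := h
        obtain ⟨ψ, hψ, hle⟩ := hcov p i m s' s hm (by omega) (hvis hpH m hm hcm)
        exact ⟨fun j => segWeight v (act ψ) i p j s' s,
          fun j => segWeight_nonneg hv (hact ψ) _ _ _ _ _,
          fun _ _ => ⟨⟨m, hcm, hseg, hle⟩, ψ, hψ, fun _ => rfl⟩,
          fun hn => absurd ⟨⟨m, hm, hcm, hseg⟩, hik⟩ hn⟩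
      · exact ⟨fun _ => 0, fun _ => le_rfl, fun h1 h2 => absurd ⟨h1, h2⟩ h, fun _ _ => rfl⟩
    choose κ hκ0 hκ1 hκ2 using hκ
    have hlive0 : live 0 s' := ⟨m₀, hm₀, hcm₀, by simp [segWeight]⟩
    have hκs' : ∀ j, κ 0 s' j = 1 := by
      obtain ⟨_, ψ, _, h⟩ := hκ1 0 s' hlive0 (by omega)
      intro j
      rw [h j]
      simp [segWeight]
    have hstep : ∀ j i s a o, 0 ≤ π (p + i) s a * v j (p + i) s a o := fun j i s a o =>
      mul_nonneg (hπ.nonneg _ _ _) (hv.nonneg _ _ _ _ _)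
    -- The largest multiple of the next gauge that fits below the current one after a step, in all
    -- contexts of nonzero weight. The equality in some context is what the induction consumes.
    have hμ : ∀ i s a (o : R × S), ∃ x : ℝ, 0 ≤ x ∧
        (∀ j, c j ≠ 0 → x * κ (i + 1) o.2 j ≤ κ i s j * (π (p + i) s a * v j (p + i) s a o)) ∧
        (live (i + 1) o.2 → i + 1 ≤ k → ∃ j, c j ≠ 0 ∧
          x * κ (i + 1) o.2 j = κ i s j * (π (p + i) s a * v j (p + i) s a o)) ∧
        (¬ (live (i + 1) o.2 ∧ i + 1 ≤ k) → x = 0) := by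
      intro i s a o
      by_cases h : live (i + 1) o.2 ∧ i + 1 ≤ k
      · obtain ⟨⟨m, hcm, hseg, hle⟩, _⟩ := hκ1 (i + 1) o.2 h.1 h.2
        obtain ⟨x, hx0, hx1, j, hj, hx2⟩ := exists_max_scale (Finset.univ.filter fun j => c j ≠ 0)
          (fun j => κ i s j * (π (p + i) s a * v j (p + i) s a o)) (fun j => κ (i + 1) o.2 j)
          (fun j _ => mul_nonneg (hκ0 _ _ _) (hstep _ _ _ _ _)) (fun j _ => hκ0 _ _ _)
          ⟨m, by simpa using hcm, by
            by_contra hn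
            have : κ (i + 1) o.2 m = 0 := le_antisymm (not_lt.1 hn) (hκ0 _ _ _)
            rw [this, mul_zero] at hle
            exact absurd hseg (not_lt.2 hle)⟩
        exact ⟨x, hx0, fun j hj => hx1 j (by simpa using hj),
          fun _ _ => ⟨j, by simpa using hj, hx2⟩, fun hn => absurd h hn⟩
      · exact ⟨0, le_rfl, fun j _ => by
          rw [zero_mul]; exact mul_nonneg (hκ0 _ _ _) (hstep _ _ _ _ _),
          fun h1 h2 => absurd ⟨h1, h2⟩ h, fun _ => rfl⟩
    choose μ hμ0 hμ1 hμ2 hμ3 using hμ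
    set Ω := transported μ s' with hΩdef
    have hΩ0 : ∀ i s, 0 ≤ Ω i s := fun i s => transported_nonneg hμ0 s' i s
    have hΩ1 : ∀ i s j, c j ≠ 0 → Ω i s * κ i s j ≤ segWeight v π i p j s' s := by
      intro i
      induction i with
      | zero =>
        intro s j _
        by_cases hs : s = s'
        · subst hs
          simp [hΩdef, transported, segWeight, hκs']
        · simp [hΩdef, transported, segWeight, hs]
      | succ i ihi =>
        intro s'' j hj
        simp only [hΩdef, transported, segWeight, Finset.sum_mul]
        refine Finset.sum_le_sum fun s _ => ?_
        rw [mul_assoc, Finset.sum_mul]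
        simp only [Finset.sum_mul]
        refine le_trans (mul_le_mul_of_nonneg_left (Finset.sum_le_sum fun a _ =>
          Finset.sum_le_sum fun r _ => hμ1 i s a (r, s'') j hj) (hΩ0 i s)) ?_
        simp only [← Finset.mul_sum]
        rw [← mul_assoc]
        refine mul_le_mul_of_nonneg_right (ihi s j hj) ?_
        exact Finset.sum_nonneg fun a _ => mul_nonneg (hπ.nonneg _ _ _)
          (Finset.sum_nonneg fun r _ => hv.nonneg _ _ _ _ _)
    have hΩ2 : ∀ i s, i ≤ k → Ω i s ≠ 0 → live i s := by
      intro i s'' hik hne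
      cases i with
      | zero =>
        by_cases hs : s'' = s'
        · exact hs ▸ hlive0
        · exact absurd (by simp [hΩdef, transported, hs]) hne
      | succ i =>
        by_contra hl
        refine hne (Finset.sum_eq_zero fun s _ => ?_)
        rw [Finset.sum_eq_zero, mul_zero]
        intro a _
        exact Finset.sum_eq_zero fun r _ => hμ3 i _ a (r, s'') fun h => hl h.1
    -- In the covered context the gauge times Ω is at most the segment probability of `π`, and this
    -- is at most `C` times the gauge; cancel the gauge.
    have hΩ3 : ∀ i s, i ≤ k → Ω i s ≤ C := by
      intro i s hik
      by_cases hne : Ω i s = 0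
      · rw [hne]; exact hC
      · obtain ⟨⟨m, hcm, hseg, hle⟩, _⟩ := hκ1 i s (hΩ2 i s hik hne) hik
        have h1 := (hΩ1 i s m hcm).trans hle
        have h2 : 0 < κ i s m := by
          by_contra hn
          have : κ i s m = 0 := le_antisymm (not_lt.1 hn) (hκ0 _ _ _)
          rw [this, mul_zero] at hle
          exact absurd hseg (not_lt.2 hle)
        exact le_of_mul_le_mul_right h1 h2
    -- replacing the gauge by the sum over all candidates
    have hcand : ∀ i s, i ≤ k → ∀ f : (J → ℝ) → ℝ, (∀ x, 0 ≤ f x) →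
        Ω i s * f (κ i s) ≤ C * ∑ ψ ∈ Cand p (p + i),
          f (fun j => segWeight v (act ψ) i p j s' s) := by
      intro i s hik f hf
      by_cases hne : Ω i s = 0
      · rw [hne, zero_mul]
        exact mul_nonneg hC (Finset.sum_nonneg fun _ _ => hf _)
      · obtain ⟨_, ψ, hψ, h⟩ := hκ1 i s (hΩ2 i s hik hne) hik
        have hκeq : κ i s = fun j => segWeight v (act ψ) i p j s' s := funext h
        refine mul_le_mul (hΩ3 i s hik) ?_ (hf _) hC
        rw [hκeq]
        exact Finset.single_le_sum (f := fun ψ => f fun j => segWeight v (act ψ) i p j s' s)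
          (fun _ _ => hf _) hψ
    have hmain := obsMass_le_telescope (v := v) (ν := π) hμ0 κ s' hκs' (k + 1) p c k (by omega)
    refine hmain.trans ?_
    set F : List (ℕ × Bool × Q) → ℝ := fun l => scheduleWeight C K l *
      obsMass v (schedulePolicy act u l) (k + 1) p (fun j => scheduleSign l * c j) s' with hF
    have hπ1 : ∀ q s a, π q s a ≤ 1 := fun q s a => by
      rw [← hπ.sum_eq q s]
      exact Finset.single_le_sum (fun a _ => hπ.nonneg q s a) (Finset.mem_univ a)
    -- First term of the residual: play `ψ` until time `p + i`, then any action. The factor `π ≤ 1`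
    -- is dropped, and the uniform action restores the sum over all actions at the price `K`.
    have hX : ∀ i l, i ≤ k → scheduleWeight C K l * (∑ s, Ω i s * ∑ a, ∑ o : R × S,
        π (p + i) s a * obsMass v (schedulePolicy act u l) (k - i) (p + i + 1)
          (fun j => scheduleSign l * c j * (κ i s j * v j (p + i) s a o)) o.2)
        ≤ ∑ ψ ∈ Cand p (p + i), F ((p + i, true, ψ) :: l) := by
      intro i l hik
      have h1 : ∑ s, Ω i s * ∑ a, ∑ o : R × S,
          π (p + i) s a * obsMass v (schedulePolicy act u l) (k - i) (p + i + 1)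
            (fun j => scheduleSign l * c j * (κ i s j * v j (p + i) s a o)) o.2
          ≤ ∑ ψ ∈ Cand p (p + i), C * (K * obsMass v
            (schedulePolicy act u ((p + i, true, ψ) :: l)) (k + 1) p
            (fun j => scheduleSign l * c j) s') := by
        have h2 : ∀ s, Ω i s * ∑ a, ∑ o : R × S,
            π (p + i) s a * obsMass v (schedulePolicy act u l) (k - i) (p + i + 1)
              (fun j => scheduleSign l * c j * (κ i s j * v j (p + i) s a o)) o.2 ≤
            C * ∑ ψ ∈ Cand p (p + i), ∑ a, ∑ o : R × S,
              obsMass v (schedulePolicy act u l) (k - i) (p + i + 1) (fun j => scheduleSign l * c j *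
                (segWeight v (act ψ) i p j s' s * v j (p + i) s a o)) o.2 := by
          intro s
          refine le_trans (mul_le_mul_of_nonneg_left (Finset.sum_le_sum fun a _ =>
            Finset.sum_le_sum fun o _ => mul_le_of_le_one_left (obsMass_nonneg _ _ _ _)
              (hπ1 _ _ _)) (hΩ0 i s)) ?_
          exact hcand i s hik (fun x => ∑ a, ∑ o : R × S,
            obsMass v (schedulePolicy act u l) (k - i) (p + i + 1)
              (fun j => scheduleSign l * c j * (x j * v j (p + i) s a o)) o.2)
            fun x => Finset.sum_nonneg fun _ _ => Finset.sum_nonneg fun _ _ =>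
              obsMass_nonneg _ _ _ _
        refine (Finset.sum_le_sum fun s _ => h2 s).trans ?_
        rw [← Finset.mul_sum, Finset.sum_comm, ← Finset.mul_sum]
        refine mul_le_mul_of_nonneg_left (Finset.sum_le_sum fun ψ _ => ?_) hC
        exact sum_obsMass_checkpoint_true hK hu' p k i hik ψ l _ s'
      refine (mul_le_mul_of_nonneg_left h1 (scheduleWeight_nonneg hC hK.le l)).trans (le_of_eq ?_)
      rw [Finset.mul_sum]
      refine Finset.sum_congr rfl fun ψ _ => ?_
      simp only [hF, scheduleWeight_cons, scheduleSign_cons, if_true, one_mul]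
      ring
    -- Second term of the residual: the carried mass at the next gauge. The segment of `ψ` includes
    -- the action at `p + i`, so it ends at `p + i + 1` without a random action; the minus sign
    -- enters `scheduleSign`.
    have hY : ∀ i l, i < k → scheduleWeight C K l * (∑ s, Ω (i + 1) s *
        obsMass v (schedulePolicy act u l) (k - i) (p + i + 1)
          (fun j => -(scheduleSign l) * c j * κ (i + 1) s j) s)
        ≤ ∑ ψ ∈ Cand p (p + i + 1), F ((p + i, false, ψ) :: l) := by
      intro i l hik
      have h1 : ∑ s, Ω (i + 1) s * obsMass v (schedulePolicy act u l) (k - i) (p + i + 1)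
            (fun j => -(scheduleSign l) * c j * κ (i + 1) s j) s
          ≤ ∑ ψ ∈ Cand p (p + i + 1), C * obsMass v
            (schedulePolicy act u ((p + i, false, ψ) :: l)) (k + 1) p
            (fun j => -(scheduleSign l) * c j) s' := by
        have h2 := fun s => hcand (i + 1) s (by omega) (fun x =>
            obsMass v (schedulePolicy act u l) (k - i) (p + i + 1)
              (fun j => -(scheduleSign l) * c j * x j) s) fun x => obsMass_nonneg _ _ _ _
        refine (Finset.sum_le_sum fun s _ => h2 s).trans ?_
        rw [← Finset.mul_sum, Finset.sum_comm, ← Finset.mul_sum]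
        refine mul_le_mul_of_nonneg_left (Finset.sum_le_sum fun ψ _ => ?_) hC
        exact sum_obsMass_checkpoint_false p k i hik.le ψ l _ s'
      refine (mul_le_mul_of_nonneg_left h1 (scheduleWeight_nonneg hC hK.le l)).trans (le_of_eq ?_)
      rw [Finset.mul_sum]
      refine Finset.sum_congr rfl fun ψ _ => ?_
      simp only [hF, scheduleWeight_cons, scheduleSign_cons, Bool.false_eq_true, if_false]
      simp only [neg_mul, one_mul, mul_one]
      ring
    have hT : ∀ i, i < k → ∑ s, Ω i s * ∑ a, ∑ o : R × S,
        obsMass v π (k + 1 - i - 1) (p + i + 1) (fun j => c j *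
          (κ i s j * (π (p + i) s a * v j (p + i) s a o) - μ i s a o * κ (i + 1) o.2 j)) o.2
        ≤ ∑ l ∈ schedules Cand n (k - i) (p + i + 1), scheduleWeight C K l *
          ((∑ s, Ω i s * ∑ a, ∑ o : R × S,
            π (p + i) s a * obsMass v (schedulePolicy act u l) (k - i) (p + i + 1)
              (fun j => scheduleSign l * c j * (κ i s j * v j (p + i) s a o)) o.2) +
          ∑ s, Ω (i + 1) s * obsMass v (schedulePolicy act u l) (k - i) (p + i + 1)
            (fun j => -(scheduleSign l) * c j * κ (i + 1) s j) s) := by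
      intro i hik
      rw [show k + 1 - i - 1 = k - i by omega]
      have h1 : ∀ s a (o : R × S), Ω i s * obsMass v π (k - i) (p + i + 1) (fun j => c j *
          (κ i s j * (π (p + i) s a * v j (p + i) s a o) - μ i s a o * κ (i + 1) o.2 j)) o.2
          ≤ Ω i s * ∑ l ∈ schedules Cand n (k - i) (p + i + 1), scheduleWeight C K l *
            obsMass v (schedulePolicy act u l) (k - i) (p + i + 1)
              (fun j => scheduleSign l * (c j * (κ i s j * (π (p + i) s a * v j (p + i) s a o)
                - μ i s a o * κ (i + 1) o.2 j))) o.2 := by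
        intro s a o
        by_cases hne : Ω i s = 0
        · rw [hne, zero_mul, zero_mul]
        refine mul_le_mul_of_nonneg_left ?_ (hΩ0 i s)
        have hfac : ∀ j, c j ≠ 0 → 0 ≤ κ i s j * (π (p + i) s a * v j (p + i) s a o)
            - μ i s a o * κ (i + 1) o.2 j := fun j hj => sub_nonneg.2 (hμ1 i s a o j hj)
        -- A residual weight survives only in contexts where `π` really reaches the new state, so
        -- the visiting assumption passes on to the induction.
        have hreach : ∀ j, c j * (κ i s j * (π (p + i) s a * v j (p + i) s a o)
            - μ i s a o * κ (i + 1) o.2 j) ≠ 0 → 0 < segWeight v π (i + 1) p j s' o.2 := by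
          intro j hj
          have hcj : c j ≠ 0 := left_ne_zero_of_mul hj
          have h2 : 0 < κ i s j * (π (p + i) s a * v j (p + i) s a o) :=
            lt_of_lt_of_le (lt_of_le_of_ne (hfac j hcj) (right_ne_zero_of_mul hj).symm)
              (sub_le_self _ (mul_nonneg (hμ0 _ _ _ _) (hκ0 _ _ _)))
          have h3 : 0 < κ i s j := lt_of_le_of_ne (hκ0 _ _ _) (left_ne_zero_of_mul h2.ne').symm
          have h4 : 0 < π (p + i) s a * v j (p + i) s a o :=
            lt_of_le_of_ne (hstep _ _ _ _ _) (right_ne_zero_of_mul h2.ne').symm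
          have h5 : 0 < segWeight v π i p j s' s := lt_of_lt_of_le
            (mul_pos (lt_of_le_of_ne (hΩ0 i s) (Ne.symm hne)) h3) (hΩ1 i s j hcj)
          refine lt_of_lt_of_le (mul_pos h5 h4) ?_
          have h6 : π (p + i) s a * v j (p + i) s a o ≤
              ∑ a, ∑ r, π (p + i) s a * v j (p + i) s a (r, o.2) := by
            refine le_trans ?_ (Finset.single_le_sum (f := fun a => ∑ r, π (p + i) s a *
              v j (p + i) s a (r, o.2)) (fun a _ => Finset.sum_nonneg fun r _ =>
                hstep j i s a (r, o.2)) (Finset.mem_univ a))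
            exact Finset.single_le_sum (f := fun r => π (p + i) s a * v j (p + i) s a (r, o.2))
              (fun r _ => hstep j i s a (r, o.2)) (Finset.mem_univ o.1)
          refine (mul_le_mul_of_nonneg_left h6 h5.le).trans ?_
          exact Finset.single_le_sum (f := fun s => segWeight v π i p j s' s *
            ∑ a, ∑ r, π (p + i) s a * v j (p + i) s a (r, o.2))
            (fun s _ => mul_nonneg (segWeight_nonneg hv hπ _ _ _ _ _)
              (Finset.sum_nonneg fun a _ => Finset.sum_nonneg fun r _ => hstep j i s a (r, o.2)))
            (Finset.mem_univ s)
        by_cases hl : live (i + 1) o.2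
        · refine ih (k - i) (p + i + 1) _ o.2 (by omega) ?_ ?_ ?_ ?_
          · intro j hj
            by_cases hcj : c j = 0
            · simp [hcj]
            · exact mul_nonneg (hc1 j hj) (hfac j hcj)
          · intro j hj
            by_cases hcj : c j = 0
            · simp [hcj]
            · exact mul_nonpos_of_nonpos_of_nonneg (hc2 j hj) (hfac j hcj)
          -- The context where the scale is attained has residual zero, so the support shrinks
          -- strictly.
          · obtain ⟨j₀, hcj₀, hj₀⟩ := hμ2 i s a o hl (by omega)
            have hsub : {j | c j * (κ i s j * (π (p + i) s a * v j (p + i) s a o)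
                - μ i s a o * κ (i + 1) o.2 j) ≠ 0} ⊂ {j | c j ≠ 0} :=
              ⟨fun j hj => left_ne_zero_of_mul hj, fun h => h hcj₀ (by simp [hj₀])⟩
            have := Set.ncard_lt_ncard hsub (Set.toFinite _)
            omega
          · intro hlt j hj hne'
            have hcj : c j ≠ 0 := left_ne_zero_of_mul hne'
            exact hVis p j s' (i + 1) o.2 hj (hvis hpH j hj hcj) hlt (hreach j hne')
        -- No positive context reaches this state, hence the residual has no positive part.
        · rw [obsMass_eq_zero hv hπ]
          · exact hrhs _ _ _ _ _
          · intro j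
            by_cases hcj : c j = 0
            · simp [hcj]
            by_cases hj : pos j
            · by_contra h
              exact hl ⟨j, hj, hcj, hreach j fun h0 => h h0.le⟩
            · exact mul_nonpos_of_nonpos_of_nonneg (hc2 j hj) (hfac j hcj)
      have h2 : ∀ (l : List (ℕ × Bool × Q)) s a (o : R × S),
          obsMass v (schedulePolicy act u l) (k - i) (p + i + 1)
              (fun j => scheduleSign l * (c j * (κ i s j * (π (p + i) s a * v j (p + i) s a o)
                - μ i s a o * κ (i + 1) o.2 j))) o.2 ≤
          π (p + i) s a * obsMass v (schedulePolicy act u l) (k - i) (p + i + 1)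
              (fun j => scheduleSign l * c j * (κ i s j * v j (p + i) s a o)) o.2 +
          μ i s a o * obsMass v (schedulePolicy act u l) (k - i) (p + i + 1)
            (fun j => -(scheduleSign l) * c j * κ (i + 1) o.2 j) o.2 := by
        intro l s a o
        rw [← obsMass_mul _ _ _ (hμ0 _ _ _ _), ← obsMass_mul _ _ _ (hπ.nonneg _ _ _)]
        refine le_trans (le_of_eq ?_) (obsMass_add_le _ _ _ _ _)
        congr 1
        ext j
        ring
      have h3 : ∀ s, Ω i s * ∑ a, ∑ o : R × S, obsMass v π (k - i) (p + i + 1) (fun j => c j *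
          (κ i s j * (π (p + i) s a * v j (p + i) s a o) - μ i s a o * κ (i + 1) o.2 j)) o.2
          ≤ ∑ l ∈ schedules Cand n (k - i) (p + i + 1), scheduleWeight C K l * (Ω i s *
            (∑ a, ∑ o : R × S, π (p + i) s a *
              obsMass v (schedulePolicy act u l) (k - i) (p + i + 1)
              (fun j => scheduleSign l * c j * (κ i s j * v j (p + i) s a o)) o.2) + Ω i s *
            ∑ a, ∑ o : R × S, μ i s a o *
              obsMass v (schedulePolicy act u l) (k - i) (p + i + 1)
              (fun j => -(scheduleSign l) * c j * κ (i + 1) o.2 j) o.2) := by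
        intro s
        simp only [Finset.mul_sum, ← Finset.sum_add_distrib]
        conv_rhs => rw [Finset.sum_comm]
        refine Finset.sum_le_sum fun a _ => ?_
        conv_rhs => rw [Finset.sum_comm]
        refine Finset.sum_le_sum fun o _ => (h1 s a o).trans ?_
        rw [Finset.mul_sum]
        refine Finset.sum_le_sum fun l _ => ?_
        have := mul_le_mul_of_nonneg_left (h2 l s a o)
          (mul_nonneg (scheduleWeight_nonneg hC hK.le l) (hΩ0 i s))
        calc _ = _ := by ring
          _ ≤ _ := this
          _ = _ := by ring
      refine (Finset.sum_le_sum fun s _ => h3 s).trans (le_of_eq ?_)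
      rw [Finset.sum_comm]
      refine Finset.sum_congr rfl fun l _ => ?_
      rw [← Finset.mul_sum, Finset.sum_add_distrib, sum_transported_succ μ s' i fun s =>
        obsMass v (schedulePolicy act u l) (k - i) (p + i + 1)
          (fun j => -(scheduleSign l) * c j * κ (i + 1) s j) s]
    -- Before the final action nothing is left to subtract: the carried mass is itself a checkpoint
    -- with random action, followed by the empty schedule.
    have hlast : ∑ s, Ω k s * obsMass v π (k + 1 - k) (p + k) (fun j => c j * κ k s j) s ≤
        ∑ l ∈ schedules Cand n (k - k) (p + k + 1), ∑ ψ ∈ Cand p (p + k),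
          F ((p + k, true, ψ) :: l) := by
      rw [Nat.sub_self, schedules_zero_right, Finset.sum_singleton]
      refine le_trans (le_of_eq ?_) (hX k [] le_rfl)
      rw [Nat.sub_self, Nat.add_sub_cancel_left]
      simp only [scheduleWeight, scheduleSign, List.map_nil, List.prod_nil, one_mul, obsMass]
      refine Finset.sum_congr rfl fun s _ => ?_
      congr 1
      refine Finset.sum_congr rfl fun a _ => Finset.sum_congr rfl fun o _ => ?_
      rw [mul_max_of_nonneg _ _ (hπ.nonneg _ _ _), mul_zero, Finset.mul_sum]
      congr 1
      exact Finset.sum_congr rfl fun j _ => by ring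
    rw [sum_schedules_succ, Finset.sum_range_succ, add_right_comm, ← Finset.sum_add_distrib]
    refine add_le_add (Finset.sum_le_sum fun i hi => ?_) (hlast.trans_eq Finset.sum_comm)
    have hik := Finset.mem_range.1 hi
    refine (hT i hik).trans ?_
    rw [Finset.sum_comm (s := Cand p (p + i)), Finset.sum_comm (s := Cand p (p + i + 1)),
      ← Finset.sum_add_distrib]
    refine Finset.sum_le_sum fun l _ => ?_
    rw [mul_add]
    exact add_le_add (hX i l hik.le) (hY i l hik)

end OffPolicy

/-! ### The recursion as a sum over trajectories -/

section Paths

variable {X S A R J : Type*} [Fintype X] [Fintype S] [Fintype A] [Fintype R] [Fintype J]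

theorem sum_consEquiv {n : ℕ} (F : (Fin (n + 1) → X) → ℝ) :
    ∑ x, F x = ∑ y, ∑ x : Fin n → X, F (Fin.cons y x) := by
  rw [← (Fin.consEquiv (fun _ : Fin (n + 1) => X)).sum_comp, Fintype.sum_prod_type]
  rfl

theorem prod_chain_cons {n : ℕ} (f : ℕ → Option X → X → ℝ) (p : ℕ) (o : Option X) (y : X)
    (x : Fin n → X) :
    ∏ t : Fin (n + 1), f (p + t) (prevEntry o (Fin.cons y x : Fin (n + 1) → X) t)
        ((Fin.cons y x : Fin (n + 1) → X) t)
      = f p o y * ∏ t : Fin n, f (p + 1 + t) (prevEntry (some y) x t) (x t) := by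
  rw [Fin.prod_univ_succ]
  congr 1
  refine Finset.prod_congr rfl fun t _ => ?_
  rw [Fin.cons_succ, Fin.val_succ, show p + (t.1 + 1) = p + 1 + t.1 by ring]
  congr 1
  rcases t with ⟨_ | t, ht⟩
  · simp only [prevEntry, Fin.succ_mk]
    rfl
  · simp only [prevEntry, Fin.succ_mk]
    rfl

/-- One step of a trajectory in the context `j`. -/
def chainStep (T : J → Option (S × A) → S → ℝ) (rew : J → S → A → R → ℝ) (ν : ℕ → S → A → ℝ)
    (j : J) (q : ℕ) (o : Option (S × A × R)) (y : S × A × R) : ℝ :=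
  T j (o.map fun z => (z.1, z.2.1)) y.1 * ν q y.1 y.2.1 * rew j y.1 y.2.1 y.2.2

/-- The recursive total positive part is the sum over all trajectories. -/
theorem sum_obsMass_eq {H : ℕ} (T : J → Option (S × A) → S → ℝ) (rew : J → S → A → R → ℝ)
    (ν : ℕ → S → A → ℝ) (v : J → ℕ → S → A → R × S → ℝ)
    (hv1 : ∀ j p s a o, p + 1 < H → v j p s a o = rew j s a o.1 * T j (some (s, a)) o.2)
    [DecidableEq S]
    (hv2 : ∀ j p s a o, p + 1 = H → v j p s a o = rew j s a o.1 * if o.2 = s then 1 else 0) :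
    ∀ (k p : ℕ) (c : J → ℝ) (o : Option (S × A × R)), p + (k + 1) = H →
    ∑ s, obsMass v ν (k + 1) p (fun j => c j * T j (o.map fun z => (z.1, z.2.1)) s) s =
      ∑ x : Fin (k + 1) → S × A × R, max (∑ j, c j * ∏ t : Fin (k + 1),
        chainStep T rew ν j (p + t) (prevEntry o x t) (x t)) 0 := by
  intro k
  induction k with
  | zero =>
    intro p c o hp
    rw [sum_consEquiv]
    have hc := fun j => prod_chain_cons (X := S × A × R) (chainStep T rew ν j) p o (n := 0)
    simp only [hc]
    simp only [Fintype.sum_prod_type, obsMass, Finset.univ_unique, Finset.sum_singleton,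
      Finset.univ_eq_empty, Finset.prod_empty, mul_one]
    refine Finset.sum_congr rfl fun s _ => Finset.sum_congr rfl fun a _ =>
      Finset.sum_congr rfl fun r _ => ?_
    -- There is no next state after the last reward. The dummy one equals `s`, so it contributes a
    -- single term.
    rw [Finset.sum_eq_single s]
    · congr 1
      refine Finset.sum_congr rfl fun j _ => ?_
      rw [hv2 _ _ _ _ _ hp]
      simp only [if_true, chainStep]
      ring
    · intro s'' _ hs
      rw [Finset.sum_eq_zero, max_self]
      intro j _
      rw [hv2 _ _ _ _ _ hp]
      simp [hs]
    · simp
  | succ k ih =>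
    intro p c o hp
    rw [sum_consEquiv]
    have hc := fun j => prod_chain_cons (X := S × A × R) (chainStep T rew ν j) p o (n := k + 1)
    simp only [hc]
    rw [Fintype.sum_prod_type]
    refine Finset.sum_congr rfl fun s _ => ?_
    rw [obsMass, Fintype.sum_prod_type]
    refine Finset.sum_congr rfl fun a _ => ?_
    rw [Fintype.sum_prod_type]
    refine Finset.sum_congr rfl fun r _ => ?_
    have h := ih (p + 1) (fun j => c j * chainStep T rew ν j p o (s, a, r)) (some (s, a, r))
      (by omega)
    simp only [← mul_assoc]
    rw [← h]
    refine Finset.sum_congr rfl fun s'' _ => ?_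
    congr 1
    ext j
    rw [hv1 _ _ _ _ _ (by omega)]
    simp only [Option.map_some, chainStep]
    ring

end Paths

/-! ### Latent MDPs as signed mixtures, and reachable states -/

section Interface

variable {S A R : Type*} [Fintype S] [Fintype A] [Fintype R] {M H : ℕ}

/-- The action weights of a policy, uniform from the horizon on. -/
noncomputable def actWeight (π : Policy S A H) (p : ℕ) (s : S) (a : A) : ℝ :=
  if h : p < H then (π ⟨p, h⟩ s a).toReal else (Fintype.card A : ℝ)⁻¹

open Classical in
/-- The step weights of a context. After the last time step the state stays. -/
noncomputable def LMDP.stepWeight (H : ℕ) (θ : LMDP S A R M) (m : Fin M) (p : ℕ) (s : S) (a : A)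
    (o : R × S) : ℝ :=
  (θ.rew m s a o.1).toReal *
    if p + 1 < H then (θ.T m (some (s, a)) o.2).toReal else if o.2 = s then 1 else 0

theorem sum_toReal_pmf {X : Type*} [Fintype X] (p : PMF X) : ∑ x, (p x).toReal = 1 := by
  rw [← ENNReal.toReal_sum fun x _ => p.apply_ne_top x, sum_pmf, ENNReal.toReal_one]

theorem isActionLaw_actWeight [Nonempty A] (π : Policy S A H) : IsActionLaw (actWeight π) := by
  constructor
  · intro p s a
    unfold actWeight
    split_ifs
    · exact ENNReal.toReal_nonneg
    · positivity
  · intro p s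
    unfold actWeight
    split_ifs
    · exact sum_toReal_pmf _
    · simp

theorem LMDP.stepWeight_nonneg (θ : LMDP S A R M) (m : Fin M) (p : ℕ) (s : S) (a : A)
    (o : R × S) : 0 ≤ θ.stepWeight H m p s a o := by
  unfold LMDP.stepWeight
  refine mul_nonneg ENNReal.toReal_nonneg ?_
  split_ifs
  exacts [ENNReal.toReal_nonneg, zero_le_one, le_rfl]

theorem LMDP.sum_stepWeight (θ : LMDP S A R M) (m : Fin M) (p : ℕ) (s : S) (a : A) :
    ∑ o, θ.stepWeight H m p s a o = 1 := by
  classical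
  simp only [LMDP.stepWeight, Fintype.sum_prod_type, ← Finset.mul_sum]
  by_cases hp : p + 1 < H <;> simp [hp, sum_toReal_pmf]

/-- The step weights of the contexts of two models. -/
noncomputable def pairWeight (H : ℕ) (θ θ' : LMDP S A R M) :
    Fin M ⊕ Fin M → ℕ → S → A → R × S → ℝ :=
  Sum.elim (θ.stepWeight H) (θ'.stepWeight H)

theorem isStepLaw_pairWeight (θ θ' : LMDP S A R M) : IsStepLaw (pairWeight H θ θ') := by
  constructor
  · rintro (m | m) p s a o
    exacts [θ.stepWeight_nonneg m p s a o, θ'.stepWeight_nonneg m p s a o]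
  · rintro (m | m) p s a
    exacts [θ.sum_stepWeight m p s a, θ'.sum_stepWeight m p s a]

/-- The signed weights of the contexts of two models, given the initial state. -/
noncomputable def initWeight (θ θ' : LMDP S A R M) (s : S) : Fin M ⊕ Fin M → ℝ :=
  Sum.elim (fun m => (θ.w m).toReal * (θ.T m none s).toReal)
    (fun m => -((θ'.w m).toReal * (θ'.T m none s).toReal))

theorem LMDP.law_toReal (θ : LMDP S A R M) (π : Policy S A H) (x : Trajectory S A R H) :
    (θ.law π x).toReal =
      ∑ m, (θ.w m).toReal * ∏ t, (θ.stepProb m π t (prevEntry none x t) (x t)).toReal := by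
  rw [LMDP.law, PMF.bind_apply, tsum_fintype, ENNReal.toReal_sum]
  · refine Finset.sum_congr rfl fun m _ => ?_
    rw [ENNReal.toReal_mul, LMDP.contextLaw, PMF.ofFintype_apply, ENNReal.toReal_prod]
  · intro m _
    exact ENNReal.mul_ne_top (PMF.apply_ne_top _ _) (PMF.apply_ne_top _ _)

/-- The difference of two probability laws has mean zero, so its positive and negative parts have
equal mass. -/
theorem two_mul_sum_max_eq_tvDist {X : Type*} [Fintype X] (p q : PMF X) :
    2 * ∑ x, max ((p x).toReal - (q x).toReal) 0 = tvDist p q := by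
  have h : ∑ x, ((p x).toReal - (q x).toReal) = 0 := by
    rw [Finset.sum_sub_distrib, sum_toReal_pmf, sum_toReal_pmf, sub_self]
  have e : ∀ d : ℝ, 2 * max d 0 = |d| + d := fun d => by
    rcases le_total d 0 with h | h
    · rw [max_eq_right h, abs_of_nonpos h]; ring
    · rw [max_eq_left h, abs_of_nonneg h]; ring
  rw [Finset.mul_sum]
  simp only [e, Finset.sum_add_distrib, h, add_zero]
  rfl

theorem tvDist_comm {X : Type*} [Fintype X] (p q : PMF X) : tvDist p q = tvDist q p :=
  Finset.sum_congr rfl fun _ _ => abs_sub_comm _ _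

theorem sum_obsMass_initWeight_aux (hH : 0 < H) (θ θ' : LMDP S A R M) (π : Policy S A H)
    (e : ℝ) :
    ∑ s, obsMass (pairWeight H θ θ') (actWeight π) H 0 (fun j => e * initWeight θ θ' s j) s =
      ∑ x, max (e * ((θ.law π x).toReal - (θ'.law π x).toReal)) 0 := by
  classical
  obtain ⟨k, rfl⟩ : ∃ k, H = k + 1 := ⟨H - 1, by omega⟩
  have h := sum_obsMass_eq (H := k + 1)
    (T := Sum.elim (fun m o s => (θ.T m o s).toReal) (fun m o s => (θ'.T m o s).toReal))
    (rew := Sum.elim (fun m s a r => (θ.rew m s a r).toReal)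
      (fun m s a r => (θ'.rew m s a r).toReal))
    (ν := actWeight π) (v := pairWeight (k + 1) θ θ')
    (by
      rintro (m | m) p s a o hp <;> simp [pairWeight, LMDP.stepWeight, hp])
    (by
      rintro (m | m) p s a o hp <;> simp [pairWeight, LMDP.stepWeight, hp])
    k 0 (fun j => e * (Sum.elim (fun m => (θ.w m).toReal) (fun m => -(θ'.w m).toReal) j)) none
    (by omega)
  refine Eq.trans ?_ (h.trans ?_)
  · refine Finset.sum_congr rfl fun s _ => ?_
    congr 1
    ext (m | m)
    · simp [initWeight, mul_assoc]
    · simp [initWeight, mul_assoc]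
  · refine Finset.sum_congr rfl fun x _ => ?_
    congr 1
    simp only [LMDP.law_toReal, Fintype.sum_sum_type, Sum.elim_inl, Sum.elim_inr, zero_add]
    rw [mul_sub, sub_eq_add_neg, Finset.mul_sum, Finset.mul_sum, ← Finset.sum_neg_distrib]
    have e1 : ∀ t : Fin (k + 1), ∀ s a, actWeight π t s a = (π t s a).toReal := by
      intro t s a
      rw [actWeight, dif_pos t.2]
    congr 1
    · refine Finset.sum_congr rfl fun m _ => ?_
      simp only [LMDP.stepProb, chainStep, ENNReal.toReal_mul, e1, mul_assoc, Sum.elim_inl]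
    · refine Finset.sum_congr rfl fun m _ => ?_
      simp only [LMDP.stepProb, chainStep, ENNReal.toReal_mul, e1, mul_assoc, Sum.elim_inr]
      ring

/-- Changing the sign of the mixture exchanges the models, which leaves the distance unchanged. This
disposes of the signs of the schedules. -/
theorem two_mul_sum_obsMass_initWeight (hH : 0 < H) (θ θ' : LMDP S A R M) (π : Policy S A H)
    {e : ℝ} (he : e = 1 ∨ e = -1) :
    2 * ∑ s, obsMass (pairWeight H θ θ') (actWeight π) H 0 (fun j => e * initWeight θ θ' s j) s =
      tvDist (θ.law π) (θ'.law π) := by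
  rw [sum_obsMass_initWeight_aux hH]
  rcases he with rfl | rfl
  · simp only [one_mul, two_mul_sum_max_eq_tvDist]
  · rw [tvDist_comm, ← two_mul_sum_max_eq_tvDist]
    simp only [neg_mul, one_mul, neg_sub]

/-- The rewards sum out. The bound `p + n < H` keeps every step of the segment before the final one,
where the step weights freeze the state. -/
theorem segWeight_eq_stateFrom (θ θ' : LMDP S A R M) (m : Fin M) (π : Policy S A H) (p : ℕ)
    (s' : S) : ∀ n s, p + n < H →
    segWeight (pairWeight H θ θ') (actWeight π) n p (Sum.inl m) s' s =
      (θ.stateFrom m π p s' n s).toReal := by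
  classical
  intro n
  induction n with
  | zero =>
    intro s _
    simp only [segWeight, LMDP.stateFrom, PMF.pure_apply]
    split_ifs <;> simp
  | succ n ih =>
    intro s'' hn
    rw [segWeight, LMDP.stateFrom, PMF.bind_apply, tsum_fintype, ENNReal.toReal_sum]
    · refine Finset.sum_congr rfl fun s _ => ?_
      rw [ENNReal.toReal_mul, ih s (by omega), dif_pos (by omega : p + n < H), PMF.bind_apply,
        tsum_fintype, ENNReal.toReal_sum]
      · congr 1
        refine Finset.sum_congr rfl fun a _ => ?_
        rw [ENNReal.toReal_mul, ← Finset.mul_sum]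
        congr 1
        · simp [actWeight, show p + n < H by omega]
        · simp only [pairWeight, Sum.elim_inl, LMDP.stepWeight,
            if_pos (show p + n + 1 < H by omega)]
          rw [← Finset.sum_mul, sum_toReal_pmf, one_mul]
      · intro a _
        exact ENNReal.mul_ne_top (PMF.apply_ne_top _ _) (PMF.apply_ne_top _ _)
    · intro s _
      exact ENNReal.mul_ne_top (PMF.apply_ne_top _ _) (PMF.apply_ne_top _ _)

theorem exists_apply_ne_zero {X : Type*} (p : PMF X) : ∃ x, p x ≠ 0 := by
  obtain ⟨x, hx⟩ := p.support_nonempty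
  exact ⟨x, (p.mem_support_iff x).1 hx⟩

/-- The entry before index `t` of an infinite sequence. -/
def prevTerm {X : Type*} (y : ℕ → X) (t : ℕ) : Option X :=
  if t = 0 then none else some (y (t - 1))

/-- The state `s` can be reached at time index `p`. -/
def LMDP.Reach (θ : LMDP S A R M) (m : Fin M) (π : Policy S A H) (p : ℕ) (s : S) : Prop :=
  ∃ y : ℕ → S × A × R, (∀ t (h : t < H), t < p → θ.stepProb m π ⟨t, h⟩ (prevTerm y t) (y t) ≠ 0) ∧
    θ.T m ((prevTerm y p).map fun z => (z.1, z.2.1)) s ≠ 0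

theorem prevTerm_update {X : Type*} (y : ℕ → X) {t q : ℕ} (h : t ≤ q) (x : X) :
    prevTerm (Function.update y q x) t = prevTerm y t := by
  unfold prevTerm
  split_ifs with h0
  · rfl
  · rw [Function.update_of_ne (by omega)]

theorem LMDP.Reach.extend {θ : LMDP S A R M} {m : Fin M} {π : Policy S A H} {p : ℕ} {s : S}
    (h : θ.Reach m π p s) (hp : p < H) (a : A) (ha : π ⟨p, hp⟩ s a ≠ 0) :
    ∃ y : ℕ → S × A × R, (∀ t (h : t < H), t < p + 1 →
      θ.stepProb m π ⟨t, h⟩ (prevTerm y t) (y t) ≠ 0) ∧ (y p).1 = s ∧ (y p).2.1 = a := by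
  obtain ⟨y, hy, hT⟩ := h
  obtain ⟨r, hr⟩ := exists_apply_ne_zero (θ.rew m s a)
  refine ⟨Function.update y p (s, a, r), fun t ht htp => ?_, by simp, by simp⟩
  rw [prevTerm_update y (by omega)]
  rcases Nat.lt_succ_iff_lt_or_eq.1 htp with h | rfl
  · rw [Function.update_of_ne h.ne]
    exact hy t ht h
  · rw [Function.update_self]
    exact mul_ne_zero (mul_ne_zero hT ha) hr

theorem LMDP.Reach.succ {θ : LMDP S A R M} {m : Fin M} {π : Policy S A H} {p : ℕ} {s s'' : S}
    (h : θ.Reach m π p s) (hp : p < H) (a : A) (ha : π ⟨p, hp⟩ s a ≠ 0)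
    (hT : θ.T m (some (s, a)) s'' ≠ 0) : θ.Reach m π (p + 1) s'' := by
  obtain ⟨y, hy, hs, ha'⟩ := h.extend hp a ha
  refine ⟨y, hy, ?_⟩
  simpa [prevTerm, hs, ha'] using hT

/-- The visiting probability refers to trajectories of full length, so the possible prefix is
continued to the horizon, choosing at each step some state, action and reward of positive
probability. -/
theorem LMDP.Reach.visitProb_pos {θ : LMDP S A R M} {m : Fin M} {π : Policy S A H} {p : ℕ} {s : S}
    (h : θ.Reach m π p s) (hp : p < H) : 0 < θ.visitProb m π ⟨p, hp⟩ s := by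
  have hext : ∀ n, p + n < H → ∃ y : ℕ → S × A × R, (∀ t (h : t < H), t < p + n + 1 →
      θ.stepProb m π ⟨t, h⟩ (prevTerm y t) (y t) ≠ 0) ∧ (y p).1 = s := by
    intro n
    induction n with
    | zero =>
      intro _
      obtain ⟨a, ha⟩ := exists_apply_ne_zero (π ⟨p, hp⟩ s)
      obtain ⟨y, hy, hs, _⟩ := h.extend hp a ha
      exact ⟨y, hy, hs⟩
    | succ n ih =>
      intro hn
      obtain ⟨y, hy, hs⟩ := ih (by omega)
      obtain ⟨s'', hs''⟩ := exists_apply_ne_zero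
        (θ.T m ((prevTerm y (p + (n + 1))).map fun z => (z.1, z.2.1)))
      have hr : θ.Reach m π (p + (n + 1)) s'' := ⟨y, fun t ht htp => hy t ht htp, hs''⟩
      obtain ⟨a, ha⟩ := exists_apply_ne_zero (π ⟨p + (n + 1), hn⟩ s'')
      obtain ⟨r, hr⟩ := exists_apply_ne_zero (θ.rew m s'' a)
      refine ⟨Function.update y (p + (n + 1)) (s'', a, r), fun t ht htp => ?_, ?_⟩
      · rw [prevTerm_update y (by omega)]
        rcases Nat.lt_succ_iff_lt_or_eq.1 htp with h | rfl
        · rw [Function.update_of_ne h.ne]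
          exact hy t ht h
        · rw [Function.update_self]
          exact mul_ne_zero (mul_ne_zero hs'' ha) hr
      · rw [Function.update_of_ne (by omega)]
        exact hs
  obtain ⟨y, hy, hs⟩ := hext (H - 1 - p) (by omega)
  rw [pos_iff_ne_zero, LMDP.visitProb, Ne, PMF.toOuterMeasure_apply_eq_zero_iff,
    Set.not_disjoint_iff]
  refine ⟨fun t => y t, ?_, hs⟩
  rw [PMF.mem_support_iff, LMDP.contextLaw, PMF.ofFintype_apply, Finset.prod_ne_zero_iff]
  intro t _
  have := hy t t.2 (by omega)
  convert this using 2
  simp only [prevEntry, prevTerm]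
  split_ifs <;> rfl

/-- A positive sum of nonnegative products has a term with all factors nonzero, which exhibits a
possible path. -/
theorem LMDP.Reach.of_segWeight_pos {θ : LMDP S A R M} (θ' : LMDP S A R M) {m : Fin M}
    {π : Policy S A H} {p : ℕ} {s' : S} (h : θ.Reach m π p s') : ∀ n s, p + n < H →
    0 < segWeight (pairWeight H θ θ') (actWeight π) n p (Sum.inl m) s' s →
    θ.Reach m π (p + n) s := by
  intro n
  induction n with
  | zero =>
    intro s _ hs
    by_cases hss : s = s'
    · exact hss ▸ h
    · simp [segWeight, hss] at hs
  | succ n ih =>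
    intro s'' hn hpos
    obtain ⟨s, _, hs⟩ := Finset.exists_ne_zero_of_sum_ne_zero hpos.ne'
    obtain ⟨a, _, ha⟩ := Finset.exists_ne_zero_of_sum_ne_zero (right_ne_zero_of_mul hs)
    obtain ⟨r, _, hr⟩ := Finset.exists_ne_zero_of_sum_ne_zero ha
    have h1 := right_ne_zero_of_mul hr
    have h2 := left_ne_zero_of_mul hr
    have h0 := left_ne_zero_of_mul hs
    simp only [pairWeight, Sum.elim_inl, LMDP.stepWeight,
      if_pos (show p + n + 1 < H by omega)] at h1
    simp only [actWeight, dif_pos (show p + n < H by omega)] at h2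
    have h3 : 0 < segWeight (pairWeight H θ θ') (actWeight π) n p (Sum.inl m) s' s := by
      rw [segWeight_eq_stateFrom θ θ' m π p s' n s (by omega)] at h0 ⊢
      exact lt_of_le_of_ne ENNReal.toReal_nonneg h0.symm
    refine (ih s (by omega) h3).succ (by omega) a (fun h => h2 (by rw [h]; rfl)) fun h =>
      right_ne_zero_of_mul h1 (by rw [h]; rfl)

end Interface

/-! ### Combinatorics of schedules -/

section ScheduleLists

variable {S A Q : Type*}

/-- The final clause is there because the checkpoint sets of the algorithm are nonempty. -/
theorem mem_schedules {Cand : ℕ → ℕ → Finset Q} {Ψ : Finset Q} (hCand : ∀ p q, Cand p q ⊆ Ψ) :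
    ∀ (n k p : ℕ) (l : List (ℕ × Bool × Q)), l ∈ schedules Cand n k p →
      l.length ≤ n ∧ (∀ e ∈ l, p ≤ e.1 ∧ e.1 < p + k ∧ e.2.2 ∈ Ψ) ∧
      l.Pairwise (fun e e' => e.1 < e'.1) ∧ (n ≠ 0 → k ≠ 0 → l ≠ []) := by
  intro n
  induction n with
  | zero =>
    intro k p l hl
    simp only [schedules, Finset.mem_singleton] at hl
    subst hl
    simp
  | succ n ih =>
    intro k p l hl
    cases k with
    | zero =>
      simp only [schedules, Finset.mem_singleton] at hl
      subst hl
      simp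
    | succ k =>
      obtain ⟨i, b, ψ, l', hi, hψ, hl', rfl⟩ : ∃ i b ψ l', i ≤ k ∧ ψ ∈ Ψ ∧
          l' ∈ schedules Cand n (k - i) (p + i + 1) ∧ l = (p + i, b, ψ) :: l' := by
        simp only [schedules, Finset.mem_union, Finset.mem_biUnion, Finset.mem_range,
          Finset.mem_image] at hl
        rcases hl with ⟨i, hi, ψ, hψ, l', hl', rfl⟩ | ⟨i, hi, ψ, hψ, l', hl', rfl⟩
        · exact ⟨i, true, ψ, l', by omega, hCand _ _ hψ, hl', rfl⟩
        · exact ⟨i, false, ψ, l', by omega, hCand _ _ hψ, hl', rfl⟩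
      obtain ⟨h1, h2, h3, _⟩ := ih _ _ _ hl'
      refine ⟨by simpa using h1, ?_, ?_, by simp⟩
      · intro e he
        rcases List.mem_cons.1 he with rfl | he
        · exact ⟨by simp, by simp; omega, hψ⟩
        · obtain ⟨h4, h5, h6⟩ := h2 e he
          exact ⟨by omega, by omega, h6⟩
      · refine List.pairwise_cons.2 ⟨fun e he => ?_, h3⟩
        have := (h2 e he).1
        simp only
        omega

/-- Unrolls the recursion: the active entry is indexed by the number of checkpoints before `q`, as
in `segmented`. -/
theorem schedulePolicy_eq (act : Q → ℕ → S → A → ℝ) (u : ℕ → S → A → ℝ) (q : ℕ) :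
    ∀ l : List (ℕ × Bool × Q), l.Pairwise (fun e e' => e.1 < e'.1) →
      ((∃ e ∈ l, e.1 = q ∧ e.2.1 = true) → schedulePolicy act u l q = u q) ∧
      (¬ (∃ e ∈ l, e.1 = q ∧ e.2.1 = true) → schedulePolicy act u l q =
        (l[(l.filter fun e => e.1 < q).length]?).elim (u q) fun e => act e.2.2 q) := by
  intro l
  induction l with
  | nil => intro _; simp [schedulePolicy]
  | cons e l ih =>
    intro hl
    obtain ⟨h1, h2⟩ := List.pairwise_cons.1 hl
    obtain ⟨ih1, ih2⟩ := ih h2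
    have hfilter : q ≤ e.1 → (l.filter fun e => e.1 < q) = [] := fun h => by
      rw [List.filter_eq_nil_iff]
      intro e' he'
      have := h1 e' he'
      simp only [decide_eq_true_eq]
      omega
    have hne : q ≤ e.1 → ¬ ∃ e' ∈ l, e'.1 = q ∧ e'.2.1 = true := by
      rintro h ⟨e', he', h3, _⟩
      have := h1 e' he'
      omega
    rcases lt_trichotomy q e.1 with h | h | h
    · have h0 : ¬ e.1 < q := by omega
      have h3 : ¬ e.1 = q := by omega
      simp [schedulePolicy, h, h0, h3, hfilter h.le, hne h.le]
    · subst h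
      have h4 := hne le_rfl
      by_cases hb : e.2.1 = true
      · simp [schedulePolicy, hb]
      · refine ⟨fun h => ?_, fun _ => ?_⟩
        · obtain ⟨e', he', h5, h6⟩ := h
          rcases List.mem_cons.1 he' with rfl | h7
          · exact absurd h6 hb
          · exact absurd ⟨e', h7, h5, h6⟩ h4
        · simp [schedulePolicy, hb, hfilter le_rfl]
    · have h0 : ¬ q < e.1 := by omega
      have h3 : ¬ q = e.1 := by omega
      have h3' : ¬ e.1 = q := by omega
      simp only [List.mem_cons, exists_eq_or_imp, h3', false_and, false_or, schedulePolicy,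
        if_neg h0, if_neg h3]
      refine ⟨ih1, fun hn => ?_⟩
      rw [ih2 hn]
      simp [h]

theorem eq_of_pairwise_of_fst_eq {l : List (ℕ × Bool × Q)}
    (hl : l.Pairwise fun e e' => e.1 < e'.1) {e e' : ℕ × Bool × Q} (he : e ∈ l) (he' : e' ∈ l)
    (h : e.1 = e'.1) : e = e' := by
  induction l with
  | nil => simp at he
  | cons a l ih =>
    obtain ⟨h1, h2⟩ := List.pairwise_cons.1 hl
    rcases List.mem_cons.1 he with hm | hm <;> rcases List.mem_cons.1 he' with hm' | hm'
    · rw [hm, hm']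
    · exact absurd h (hm ▸ h1 _ hm').ne
    · exact absurd h (hm' ▸ h1 _ hm).ne'
    · exact ih h2 hm hm'

/-- The times determine the length, so the policies need comparing only at positions present in both
lists. Padding of tuples thus loses no information. -/
theorem schedule_ext {d : ℕ} {l l' : List (ℕ × Bool × Q)}
    (hl : l.Pairwise fun e e' => e.1 < e'.1) (hl' : l'.Pairwise fun e e' => e.1 < e'.1)
    (hd : l.length ≤ d)
    (h1 : ∀ q, (∃ e ∈ l, e.1 = q) ↔ ∃ e ∈ l', e.1 = q)
    (h2 : ∀ q, (∃ e ∈ l, e.1 = q ∧ e.2.1 = true) ↔ ∃ e ∈ l', e.1 = q ∧ e.2.1 = true)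
    (h3 : ∀ i < d, (x y : Q) → (l[i]?).map (·.2.2) = some x → (l'[i]?).map (·.2.2) = some y →
      x = y) : l = l' := by
  have hs : (l.map Prod.fst).Pairwise (· < ·) := List.pairwise_map.2 hl
  have hs' : (l'.map Prod.fst).Pairwise (· < ·) := List.pairwise_map.2 hl'
  have hfst : l.map Prod.fst = l'.map Prod.fst := by
    refine List.Perm.eq_of_pairwise (le := (· < ·)) (fun a b _ _ h h' => absurd h (lt_asymm h'))
      hs hs' ?_
    rw [List.perm_ext_iff_of_nodup (hs.imp fun h => h.ne) (hs'.imp fun h => h.ne)]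
    intro q
    simpa only [List.mem_map] using h1 q
  have hlen : l.length = l'.length := by simpa using congrArg List.length hfst
  refine List.ext_getElem hlen fun i hi hi' => ?_
  have e1 : (l[i]).1 = (l'[i]).1 := by
    have := congrArg (fun m => m[i]?) hfst
    simpa [hi, hi'] using this
  have e3 : (l[i]).2.2 = (l'[i]).2.2 :=
    h3 i (by omega) _ _ (by simp [hi]) (by simp [hi'])
  have e2 : (l[i]).2.1 = (l'[i]).2.1 := by
    rw [Bool.eq_iff_iff]
    constructor
    · intro h
      obtain ⟨e, he, h4, h5⟩ := (h2 _).1 ⟨_, List.getElem_mem hi, e1, h⟩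
      rwa [← eq_of_pairwise_of_fst_eq hl' he (List.getElem_mem hi') h4]
    · intro h
      obtain ⟨e, he, h4, h5⟩ := (h2 _).2 ⟨_, List.getElem_mem hi', e1.symm, h⟩
      rwa [← eq_of_pairwise_of_fst_eq hl he (List.getElem_mem hi) h4]
  exact Prod.ext e1 (Prod.ext e2 e3)

end ScheduleLists

/-! ### Schedules as queries of the algorithm -/

section ScheduleQueries

variable {S A : Type*} [Fintype S] [Fintype A] [Nonempty A] {H d : ℕ}

/-- The policies of a schedule, followed by the uniform policy. -/
noncomputable def scheduleTuple (d : ℕ) (l : List (ℕ × Bool × Policy S A H)) :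
    Fin d → Policy S A H :=
  fun i => ((l[i.1]?).map (·.2.2)).getD unifPolicy

open Classical in
/-- The time steps of a schedule. -/
noncomputable def scheduleTimes (l : List (ℕ × Bool × Policy S A H)) : Finset (Fin H) :=
  Finset.univ.filter fun t => ∃ e ∈ l, e.1 = t

open Classical in
/-- The checkpoints with random actions of a schedule. -/
noncomputable def scheduleSwitching (l : List (ℕ × Bool × Policy S A H))
    (h : (scheduleTimes l).Nonempty ∧ (scheduleTimes l).card ≤ d) : Switching H d :=
  ⟨⟨scheduleTimes l, h⟩, fun t => decide (∃ e ∈ l, e.1 = t.1.1 ∧ e.2.1 = true)⟩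

/-- The times increase strictly, so passing from the list to the set merges no entries. Used for the
index of the current segment and for the number of checkpoints. -/
theorem card_filter_scheduleTimes {l : List (ℕ × Bool × Policy S A H)}
    (hl : l.Pairwise fun e e' => e.1 < e'.1) (hH : ∀ e ∈ l, e.1 < H) (P : ℕ → Prop)
    [DecidablePred P] :
    ((scheduleTimes l).filter fun t => P t.1).card = (l.filter fun e => P e.1).length := by
  classical
  have h : ((scheduleTimes l).filter fun t => P t.1).map Fin.valEmbedding =
      ((l.filter fun e => P e.1).map Prod.fst).toFinset := by
    ext q
    simp only [scheduleTimes, Finset.mem_map, Finset.mem_filter, Finset.mem_univ, true_and,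
      Fin.valEmbedding_apply, List.mem_toFinset, List.mem_map, List.mem_filter, decide_eq_true_eq]
    constructor
    · rintro ⟨t, ⟨⟨e, he, h1⟩, h2⟩, rfl⟩
      exact ⟨e, ⟨he, h1 ▸ h2⟩, h1⟩
    · rintro ⟨e, ⟨he, h1⟩, rfl⟩
      exact ⟨⟨e.1, hH e he⟩, ⟨⟨e, he, rfl⟩, h1⟩, rfl⟩
  have hn : ((l.filter fun e => P e.1).map Prod.fst).Nodup := by
    have : ((l.filter fun e => P e.1).map Prod.fst).Pairwise (· < ·) :=
      List.pairwise_map.2 (hl.filter _)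
    exact this.imp fun h => h.ne
  rw [← Finset.card_map Fin.valEmbedding, h, List.toFinset_card_of_nodup hn, List.length_map]

theorem scheduleTimes_spec {l : List (ℕ × Bool × Policy S A H)}
    (hl : l.Pairwise fun e e' => e.1 < e'.1) (hH : ∀ e ∈ l, e.1 < H) (hd : l.length ≤ d)
    (hne : l ≠ []) : (scheduleTimes l).Nonempty ∧ (scheduleTimes l).card ≤ d := by
  classical
  constructor
  · obtain ⟨e, he⟩ := List.exists_mem_of_ne_nil l hne
    exact ⟨⟨e.1, hH e he⟩, Finset.mem_filter.2 ⟨Finset.mem_univ _, e, he, rfl⟩⟩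
  · have := card_filter_scheduleTimes hl hH fun _ => True
    simp only [Finset.filter_true, decide_true, List.filter_true] at this
    omega

theorem actWeight_unifPolicy (p : ℕ) (s : S) (a : A) :
    actWeight (unifPolicy : Policy S A H) p s a = (Fintype.card A : ℝ)⁻¹ := by
  unfold actWeight unifPolicy
  split_ifs <;> simp

theorem actWeight_segmented {l : List (ℕ × Bool × Policy S A H)}
    (hl : l.Pairwise fun e e' => e.1 < e'.1) (hH : ∀ e ∈ l, e.1 < H) (hd : l.length ≤ d)
    (h : (scheduleTimes l).Nonempty ∧ (scheduleTimes l).card ≤ d) {q : ℕ} (hq : q < H) :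
    actWeight (segmented (Fin.snoc (scheduleTuple d l) unifPolicy) (scheduleSwitching l h)) q =
      schedulePolicy actWeight (actWeight (unifPolicy : Policy S A H)) l q := by
  classical
  obtain ⟨h1, h2⟩ := schedulePolicy_eq actWeight (actWeight (unifPolicy : Policy S A H)) q l hl
  have hc := card_filter_scheduleTimes hl hH fun t => t < q
  have hcond : (∃ hm : (⟨q, hq⟩ : Fin H) ∈ (scheduleSwitching l h).1.1,
      (scheduleSwitching l h).2 ⟨⟨q, hq⟩, hm⟩ = true) ↔ ∃ e ∈ l, e.1 = q ∧ e.2.1 = true := by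
    constructor
    · rintro ⟨_, h4⟩
      simpa only [scheduleSwitching, decide_eq_true_eq] using h4
    · rintro ⟨e, he, h4, h5⟩
      refine ⟨?_, ?_⟩
      · simp only [scheduleSwitching, scheduleTimes, Finset.mem_filter, Finset.mem_univ, true_and]
        exact ⟨e, he, h4⟩
      · simp only [scheduleSwitching, decide_eq_true_eq]
        exact ⟨e, he, h4, h5⟩
  have hval : actWeight (segmented (Fin.snoc (scheduleTuple d l) unifPolicy)
      (scheduleSwitching l h)) q = fun s a => (segmented (Fin.snoc (scheduleTuple d l) unifPolicy)
      (scheduleSwitching l h) ⟨q, hq⟩ s a).toReal := by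
    funext s a
    rw [actWeight, dif_pos hq]
  rw [hval]
  unfold segmented
  by_cases hC : ∃ e ∈ l, e.1 = q ∧ e.2.1 = true
  · rw [if_pos (hcond.2 hC), h1 hC]
    funext s a
    rw [actWeight, dif_pos hq]
    rfl
  · rw [if_neg fun h' => hC (hcond.1 h'), h2 hC]
    have hidx : ((scheduleSwitching l h).1.1.filter (· < (⟨q, hq⟩ : Fin H))).card =
        (l.filter fun e => e.1 < q).length := by
      rw [← hc]
      congr 1
    have hfun : ∀ (c : ℕ) (hcd : c < d + 1), c = (l.filter fun e => e.1 < q).length →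
        (Fin.snoc (scheduleTuple d l) unifPolicy : Fin (d + 1) → Policy S A H) ⟨c, hcd⟩ =
        (l[c]?).elim unifPolicy fun e => e.2.2 := by
      intro c hcd _
      by_cases hlt : c < d
      · have : (⟨c, hcd⟩ : Fin (d + 1)) = Fin.castSucc ⟨c, hlt⟩ := rfl
        rw [this, Fin.snoc_castSucc]
        simp only [scheduleTuple]
        cases l[c]? <;> rfl
      · have : (⟨c, hcd⟩ : Fin (d + 1)) = Fin.last d := by
          ext
          simp only [Fin.val_last]
          omega
        rw [this, Fin.snoc_last, List.getElem?_eq_none (by omega)]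
        rfl
    rw [hfun _ _ hidx, hidx]
    funext s a
    cases l[(l.filter fun e => e.1 < q).length]? with
    | none => simp only [Option.elim_none]; rw [actWeight, dif_pos hq]
    | some e => simp only [Option.elim_some]; rw [actWeight, dif_pos hq]

/-- Ensures that in the Cauchy–Schwarz estimate each query of the algorithm is charged for one
schedule only. -/
theorem scheduleQuery_injective {l l' : List (ℕ × Bool × Policy S A H)}
    (hl : l.Pairwise fun e e' => e.1 < e'.1) (hl' : l'.Pairwise fun e e' => e.1 < e'.1)
    (hH : ∀ e ∈ l, e.1 < H) (hH' : ∀ e ∈ l', e.1 < H)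
    (hd : l.length ≤ d)
    (h : (scheduleTimes l).Nonempty ∧ (scheduleTimes l).card ≤ d)
    (h' : (scheduleTimes l').Nonempty ∧ (scheduleTimes l').card ≤ d)
    (e1 : scheduleTuple d l = scheduleTuple d l')
    (e2 : scheduleSwitching l h = scheduleSwitching l' h') : l = l' := by
  classical
  have key : ∀ {l : List (ℕ × Bool × Policy S A H)}, (∀ e ∈ l, e.1 < H) → ∀ h q,
      ((∃ e ∈ l, e.1 = q) ↔ ∃ hq : q < H, (⟨q, hq⟩ : Fin H) ∈
        (scheduleSwitching (d := d) l h).1.1) ∧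
      ((∃ e ∈ l, e.1 = q ∧ e.2.1 = true) ↔ ∃ hq : q < H, ∃ hm : (⟨q, hq⟩ : Fin H) ∈
        (scheduleSwitching (d := d) l h).1.1,
        (scheduleSwitching l h).2 ⟨⟨q, hq⟩, hm⟩ = true) := by
    intro l hH h q
    constructor
    · constructor
      · rintro ⟨e, he, rfl⟩
        exact ⟨hH e he, Finset.mem_filter.2 ⟨Finset.mem_univ _, e, he, rfl⟩⟩
      · rintro ⟨hq, hm⟩
        simpa only [scheduleSwitching, scheduleTimes, Finset.mem_filter, Finset.mem_univ,
          true_and] using hm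
    · constructor
      · rintro ⟨e, he, rfl, hb⟩
        refine ⟨hH e he, Finset.mem_filter.2 ⟨Finset.mem_univ _, e, he, rfl⟩, ?_⟩
        simp only [scheduleSwitching, decide_eq_true_eq]
        exact ⟨e, he, rfl, hb⟩
      · rintro ⟨hq, hm, hb⟩
        simpa only [scheduleSwitching, decide_eq_true_eq] using hb
  refine schedule_ext hl hl' hd (fun q => ?_) (fun q => ?_) fun i hi x y hx hy => ?_
  · rw [(key hH h q).1, (key hH' h' q).1, e2]
  · rw [(key hH h q).2, (key hH' h' q).2, e2]
  · have := congrFun e1 ⟨i, hi⟩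
    simpa [scheduleTuple, hx, hy] using this

end ScheduleQueries

/-! ### From failed coverage doubling to a bound on the distance -/

section Coverage

variable {S A R : Type*} [Fintype S] [Fintype A] [Fintype R] [Nonempty A] {M H d : ℕ}

/-- Unless `π` doubles the coverage of `Ψ`, few policies from `Ψ` cover all segments of `π` with
given end points in time. -/
theorem exists_cover_of_not_doublesCoverage (θs : LMDP S A R M) {Ψ : Finset (Policy S A H)}
    (hΨ : Ψ.Nonempty) {π : Policy S A H} (hπ : ¬ DoublesCoverage θs Ψ π) :
    ∃ Cand : ℕ → ℕ → Finset (Policy S A H), (∀ p q, Cand p q ⊆ Ψ) ∧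
      (∀ p q, (Cand p q).card ≤ M * Fintype.card S ^ 2) ∧
      ∀ p n m s' s, p + n < H → θs.Reach m π p s' → ∃ ψ ∈ Cand p (p + n),
        (θs.stateFrom m π p s' n s).toReal ≤
          (if Fintype.card S = 1 then 1 else 2) * (θs.stateFrom m ψ p s' n s).toReal := by
  classical
  have hmax : ∀ (p q : ℕ) (z : Fin M × S × S), ∃ ψ ∈ Ψ, ∀ ψ' ∈ Ψ,
      θs.stateFrom z.1 ψ' p z.2.1 (q - p) z.2.2 ≤ θs.stateFrom z.1 ψ p z.2.1 (q - p) z.2.2 :=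
    fun p q z => Ψ.exists_max_image _ hΨ
  choose f hf hf' using hmax
  refine ⟨fun p q => Finset.univ.image (f p q), fun p q => ?_, fun p q => ?_, ?_⟩
  · intro ψ hψ
    obtain ⟨z, _, rfl⟩ := Finset.mem_image.1 hψ
    exact hf p q z
  · refine Finset.card_image_le.trans ?_
    simp [sq]
  · intro p n m s' s hpn hr
    refine ⟨f p (p + n) (m, s', s), Finset.mem_image_of_mem _ (Finset.mem_univ _), ?_⟩
    split_ifs with hS
    -- With one state all segment probabilities are 1, so the factor 2 can be saved; the final
    -- constants need this.
    · have : Subsingleton S := Fintype.card_le_one_iff_subsingleton.1 hS.le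
      have hone : ∀ p : PMF S, p s = 1 := fun p => by
        have := sum_pmf p
        rwa [Fintype.sum_subsingleton _ s] at this
      rw [hone, hone, one_mul]
    · have h1 : θs.stateFrom m π p s' n s ≤
          2 * Ψ.sup (fun ψ => θs.segProb m ψ p (p + n + 1) s' s) := by
        by_contra! h
        refine hπ ⟨m, ⟨p, by omega⟩, p + n + 1, s, s', by simp, by omega,
          hr.visitProb_pos _, ?_⟩
        simpa only [LMDP.segProb, show p + n + 1 - (p + 1) = n by omega] using h
      have h2 : Ψ.sup (fun ψ => θs.segProb m ψ p (p + n + 1) s' s) ≤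
          θs.stateFrom m (f p (p + n) (m, s', s)) p s' n s := by
        refine Finset.sup_le fun ψ hψ => ?_
        have := hf' p (p + n) (m, s', s) ψ hψ
        simpa only [LMDP.segProb, show p + n + 1 - (p + 1) = n by omega,
          Nat.add_sub_cancel_left] using this
      have h3 := h1.trans (mul_le_mul_right h2 2)
      have h4 := ENNReal.toReal_mono
        (ENNReal.mul_ne_top (by norm_num) (PMF.apply_ne_top _ _)) h3
      simpa using h4

/-- A total function is convenient for images of finite sets; lists that are no valid schedules get
an arbitrary checkpoint, whence `0 < H` and `0 < d`. -/
theorem exists_scheduleQuery (hH : 0 < H) (hd : 0 < d) :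
    ∃ f : List (ℕ × Bool × Policy S A H) → (Fin d → Policy S A H) × Switching H d,
      ∀ l, ((scheduleTimes l).Nonempty ∧ (scheduleTimes l).card ≤ d) →
        ∃ h, f l = (scheduleTuple d l, scheduleSwitching l h) := by
  classical
  refine ⟨fun l => if h : (scheduleTimes l).Nonempty ∧ (scheduleTimes l).card ≤ d then
    (scheduleTuple d l, scheduleSwitching l h) else
    (scheduleTuple d l, ⟨⟨{⟨0, hH⟩}, by simpa using Nat.succ_le_of_lt hd⟩, fun _ => false⟩), fun l h => ⟨h, ?_⟩⟩
  exact dif_pos h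

/-- The policy executed for a query. -/
noncomputable def queryPolicy (q : (Fin d → Policy S A H) × Switching H d) : Policy S A H :=
  segmented (Fin.snoc q.1 unifPolicy) q.2

theorem queryPolicy_eq_unifPolicy {q : (Fin d → Policy S A H) × Switching H d}
    (h : ∀ i, q.1 i = unifPolicy) : queryPolicy q = unifPolicy := by
  have h1 : ∀ i, (Fin.snoc q.1 unifPolicy : Fin (d + 1) → Policy S A H) i = unifPolicy := by
    intro i
    refine Fin.lastCases ?_ (fun i => ?_) i
    · exact Fin.snoc_last _ _
    · exact (Fin.snoc_castSucc _ _ _).trans (h i)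
  funext t
  simp only [queryPolicy, segmented, h1]
  split_ifs <;> rfl

theorem scheduleSign_eq {Q : Type*} (l : List (ℕ × Bool × Q)) :
    scheduleSign l = 1 ∨ scheduleSign l = -1 := by
  induction l with
  | nil => simp [scheduleSign]
  | cons e l ih =>
    rw [scheduleSign_cons]
    rcases ih with h | h <;> rw [h] <;> split_ifs <;> simp

/-- The distance of two models under `π` is controlled by their distances under the segmented
policies of the schedules. -/
theorem tvDist_le_sum_schedules (hH : 0 < H) (hd : d = 2 * M - 1) (hM : 0 < M)
    (θs θ : LMDP S A R M) (π : Policy S A H)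
    {Cand : ℕ → ℕ → Finset (Policy S A H)} {Ψ : Finset (Policy S A H)}
    (hCand : ∀ p q, Cand p q ⊆ Ψ) {C : ℝ} (hC : 0 ≤ C)
    (hcov : ∀ p n m s' s, p + n < H → θs.Reach m π p s' → ∃ ψ ∈ Cand p (p + n),
        (θs.stateFrom m π p s' n s).toReal ≤ C * (θs.stateFrom m ψ p s' n s).toReal)
    (f : List (ℕ × Bool × Policy S A H) → (Fin d → Policy S A H) × Switching H d)
    (hf : ∀ l, ((scheduleTimes l).Nonempty ∧ (scheduleTimes l).card ≤ d) →
        ∃ h, f l = (scheduleTuple d l, scheduleSwitching l h)) :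
    tvDist (θs.law π) (θ.law π) ≤
      ∑ l ∈ schedules Cand d H 0, scheduleWeight C (Fintype.card A) l *
        tvDist (θs.law (queryPolicy (f l))) (θ.law (queryPolicy (f l))) := by
  classical
  have hmain : ∀ s, obsMass (pairWeight H θs θ) (actWeight π) H 0 (initWeight θs θ s) s ≤
      ∑ l ∈ schedules Cand d H 0, scheduleWeight C (Fintype.card A) l *
        obsMass (pairWeight H θs θ) (schedulePolicy actWeight (actWeight (unifPolicy : Policy S A H)) l) H 0
          (fun j => scheduleSign l * initWeight θs θ s j) s := by
    intro s
    refine obsMass_le_sum_schedules (isStepLaw_pairWeight θs θ) isActionLaw_actWeight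
      (by positivity) (isActionLaw_actWeight (unifPolicy : Policy S A H))
      (fun p s a => actWeight_unifPolicy p s a)
      (isActionLaw_actWeight π) (H := H) (fun j => j.isLeft = true)
      (fun p j s => Sum.elim (fun m => θs.Reach m π p s) (fun _ => True) j) ?_ Cand hC ?_
      d H 0 _ s (by omega) ?_ ?_ ?_ ?_
    · rintro p (m | m) s' n s hpos hv hpn hseg
      · exact hv.of_segWeight_pos θ n s hpn hseg
      · simp at hpos
    · rintro p n (m | m) s' s hpos hpn hv
      · obtain ⟨ψ, hψ, h⟩ := hcov p n m s' s hpn hv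
        refine ⟨ψ, hψ, ?_⟩
        rwa [segWeight_eq_stateFrom _ _ _ _ _ _ _ _ hpn,
          segWeight_eq_stateFrom _ _ _ _ _ _ _ _ hpn]
      · simp at hpos
    · rintro (m | m) hpos
      · exact mul_nonneg ENNReal.toReal_nonneg ENNReal.toReal_nonneg
      · simp at hpos
    · rintro (m | m) hpos
      · simp at hpos
      · exact neg_nonpos.2 (mul_nonneg ENNReal.toReal_nonneg ENNReal.toReal_nonneg)
    -- Both models together have `2 * M = d + 1` contexts.
    · refine (Set.ncard_le_card _).trans ?_
      simp
      omega
    · rintro _ (m | m) hpos hc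
      · have h1 := right_ne_zero_of_mul hc
        -- No step precedes time index 0, so any sequence is a witness and only the initial law
        -- matters.
        refine ⟨fun _ => (s, Classical.arbitrary A, Classical.choice ?_), by simp, ?_⟩
        · exact ⟨(exists_apply_ne_zero (θs.rew m s (Classical.arbitrary A))).choose⟩
        · simp only [prevTerm, if_pos, Option.map_none]
          intro h
          rw [h] at h1
          simp at h1
      · simp at hpos
  have h1 := two_mul_sum_obsMass_initWeight hH θs θ π (e := 1) (Or.inl rfl)
  simp only [one_mul] at h1
  rw [← h1]
  calc _ ≤ 2 * ∑ s, ∑ l ∈ schedules Cand d H 0, scheduleWeight C (Fintype.card A) l *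
        obsMass (pairWeight H θs θ) (schedulePolicy actWeight (actWeight (unifPolicy : Policy S A H)) l) H 0
          (fun j => scheduleSign l * initWeight θs θ s j) s :=
        mul_le_mul_of_nonneg_left (Finset.sum_le_sum fun s _ => hmain s) (by norm_num)
    _ = _ := by
      rw [Finset.sum_comm, Finset.mul_sum]
      refine Finset.sum_congr rfl fun l hl => ?_
      obtain ⟨h2, h3, h4, h5⟩ := mem_schedules hCand d H 0 l hl
      have h3' : ∀ e ∈ l, e.1 < H := fun e he => by simpa using (h3 e he).2.1
      have h6 := scheduleTimes_spec h4 h3' h2 (h5 (by omega) hH.ne')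
      obtain ⟨h7, h8⟩ := hf l h6
      rw [← two_mul_sum_obsMass_initWeight hH θs θ _ (scheduleSign_eq l), ← Finset.mul_sum,
        mul_left_comm]
      congr 2
      refine Finset.sum_congr rfl fun s _ => obsMass_congr _ _ _ _ fun q _ hq => ?_
      rw [h8, queryPolicy, actWeight_segmented h4 h3' h2 h7 (by omega)]

/-- Cauchy–Schwarz twice. Uniform-only schedules all execute the same policy, so their weights are
added up first; squaring them separately would charge this single distance many times. -/
theorem sum_mul_le_of_unif {ι : Type*} (s : Finset ι) (w T : ι → ℝ) (hw : ∀ i ∈ s, 0 ≤ w i)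
    (P : ι → Prop) [DecidablePred P] {x y W V : ℝ} (hT : ∀ i ∈ s, P i → T i = x)
    (hW : ∑ i ∈ s, (if P i then w i else 0) ≤ W) (hV : ∑ i ∈ s, w i ^ 2 ≤ V)
    (hy : ∑ i ∈ s with ¬ P i, T i ^ 2 ≤ y) (h0 : 0 ≤ ∑ i ∈ s, w i * T i) (hx : 0 ≤ x) :
    (∑ i ∈ s, w i * T i) ^ 2 ≤ (W ^ 2 + V) * (x ^ 2 + y) := by
  have hW0 : 0 ≤ W := (Finset.sum_nonneg fun i hi => by
    split_ifs
    exacts [hw i hi, le_rfl]).trans hW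
  have h1 : ∑ i ∈ s with P i, w i * T i ≤ W * x := by
    rw [← Finset.sum_filter] at hW
    calc _ = (∑ i ∈ s with P i, w i) * x := by
          rw [Finset.sum_mul]
          refine Finset.sum_congr rfl fun i hi => ?_
          rw [Finset.mem_filter] at hi
          rw [hT i hi.1 hi.2]
      _ ≤ _ := mul_le_mul_of_nonneg_right hW hx
  have hV0 : ∑ i ∈ s with ¬ P i, w i ^ 2 ≤ V :=
    (Finset.sum_le_sum_of_subset_of_nonneg (Finset.filter_subset _ _)
      fun _ _ _ => sq_nonneg _).trans hV
  have hy0 : 0 ≤ y := (Finset.sum_nonneg fun _ _ => sq_nonneg _).trans hy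
  have hV1 : 0 ≤ V := (Finset.sum_nonneg fun _ _ => sq_nonneg _).trans hV
  have h2 : (∑ i ∈ s with ¬ P i, w i * T i) ^ 2 ≤ V * y :=
    (Finset.sum_mul_sq_le_sq_mul_sq _ _ _).trans
      (mul_le_mul hV0 hy (Finset.sum_nonneg fun _ _ => sq_nonneg _) hV1)
  rw [← Finset.sum_filter_add_sum_filter_not s P] at h0 ⊢
  set a := ∑ i ∈ s with P i, w i * T i
  set b := ∑ i ∈ s with ¬ P i, w i * T i
  have h3 : b ≤ √V * √y := by
    rw [← Real.sqrt_mul hV1]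
    exact Real.le_sqrt_of_sq_le h2
  have h4 : a + b ≤ W * x + √V * √y := add_le_add h1 h3
  have h5 := Real.sq_sqrt hV1
  have h6 := Real.sq_sqrt hy0
  calc (a + b) ^ 2 ≤ (W * x + √V * √y) ^ 2 := by gcongr
    _ ≤ (W ^ 2 + √V ^ 2) * (x ^ 2 + √y ^ 2) := by nlinarith [sq_nonneg (W * √y - √V * x)]
    _ = _ := by rw [h5, h6]

theorem prod_ite_eq_ite_forall {Q : Type*} (C K : ℝ) (P : Q → Prop) [DecidablePred P]
    (l : List (ℕ × Bool × Q)) :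
    (l.map fun e => if P e.2.2 then C * (if e.2.1 = true then K else 1) else 0).prod =
      if ∀ e ∈ l, P e.2.2 then scheduleWeight C K l else 0 := by
  induction l with
  | nil => simp [scheduleWeight]
  | cons e l ih =>
    rw [List.map_cons, List.prod_cons, ih, scheduleWeight_cons]
    have h : (∀ e' ∈ e :: l, P e'.2.2) ↔ P e.2.2 ∧ ∀ e' ∈ l, P e'.2.2 := List.forall_mem_cons
    rw [if_congr h rfl rfl]
    by_cases h1 : P e.2.2
    · simp only [h1, if_true, true_and, mul_ite, mul_zero]
    · simp only [h1, if_false, false_and, zero_mul]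

theorem prod_sq_eq {Q : Type*} (C K : ℝ) (l : List (ℕ × Bool × Q)) :
    (l.map fun e => (C * if e.2.1 = true then K else 1) ^ 2).prod = scheduleWeight C K l ^ 2 := by
  induction l with
  | nil => simp [scheduleWeight]
  | cons e l ih => rw [List.map_cons, List.prod_cons, ih, scheduleWeight_cons, mul_pow _ (scheduleWeight C K l)]

/-- The first summand has no factor for the number of candidates, so the room for `C ^ 2` comes from
`C ≤ S`; this is where the case `S = 1` needs `C = 1`. -/
theorem schedule_constants_le {H M S A : ℝ} {d : ℕ} (hd : d ≠ 0) (hH : 3 ≤ H) (hM : 1 ≤ M) (hA : 1 ≤ A)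
    {C : ℝ} (hS : S = 1 ∧ C = 1 ∨ 2 ≤ S ∧ C = 2) :
    ((H * (C * (A + 1))) ^ d) ^ 2 + (H * (M * S ^ 2 * (C ^ 2 * (A ^ 2 + 1)))) ^ d ≤
      (8 * H ^ 2) ^ d * (M * S ^ 2 * A ^ 2) ^ d := by
  have hS0 : 1 ≤ S := by rcases hS with h | h <;> linarith [h.1]
  have hC : 0 ≤ C := by rcases hS with h | h <;> rw [h.2] <;> norm_num
  rw [← pow_mul, mul_comm d 2, pow_mul, ← mul_pow]
  refine (pow_add_pow_le (sq_nonneg _) (by positivity) hd).trans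
    (pow_le_pow_left₀ (by positivity) ?_ d)
  have hA2 : (A + 1) ^ 2 ≤ 4 * A ^ 2 := by nlinarith
  have hA3 : A ^ 2 + 1 ≤ 2 * A ^ 2 := by nlinarith
  have hCS : C ^ 2 ≤ S ^ 2 := by
    refine pow_le_pow_left₀ hC ?_ 2
    rcases hS with h | h <;> rw [h.2]
    exacts [h.1.ge, h.1]
  have hC4 : C ^ 2 ≤ 4 := by rcases hS with h | h <;> rw [h.2] <;> norm_num
  have h1 : (H * (C * (A + 1))) ^ 2 ≤ H ^ 2 * (M * S ^ 2 * (4 * A ^ 2)) := by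
    calc _ = H ^ 2 * (1 * C ^ 2 * (A + 1) ^ 2) := by ring
      _ ≤ _ := by gcongr
  have h2 : H * (M * S ^ 2 * (C ^ 2 * (A ^ 2 + 1))) ≤ H * (M * S ^ 2 * (4 * (2 * A ^ 2))) := by
    gcongr
  -- As `H ≥ 3`, the term linear in `H` is at most a third of its quadratic version, and 4 + 8/3 ≤
  -- 8.
  have h3 : H * (M * S ^ 2 * (4 * (2 * A ^ 2))) * 3 ≤ H * (M * S ^ 2 * (4 * (2 * A ^ 2))) * H := by
    gcongr
  have h4 : 0 ≤ H ^ 2 * (M * S ^ 2 * A ^ 2) := by positivity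
  nlinarith

open Classical in
/-- If `π` does not double the coverage of `Ψ`, two models that are close under the uniform policy
and under all query policies are close under `π`. -/
theorem tvDist_sq_le_of_not_doublesCoverage (hH : 2 * M < H) (hd : d = 2 * M - 1)
    (θs θ : LMDP S A R M) {Ψ : Finset (Policy S A H)} (hΨ : unifPolicy ∈ Ψ) {π : Policy S A H}
    (hπ : ¬ DoublesCoverage θs Ψ π) :
    tvDist (θs.law π) (θ.law π) ^ 2 ≤
      (8 * (H : ℝ) ^ 2) ^ d * (M * Fintype.card S ^ 2 * Fintype.card A ^ 2) ^ d *
      (tvDist (θs.law (unifPolicy : Policy S A H)) (θ.law unifPolicy) ^ 2 +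
        ∑ q ∈ (Fintype.piFinset fun _ : Fin d => Ψ).filter (fun ψ => ∃ i, ψ i ≠ unifPolicy) ×ˢ
          (Finset.univ : Finset (Switching H d)),
          tvDist (θs.law (queryPolicy q)) (θ.law (queryPolicy q)) ^ 2) := by
  have htv : ∀ π : Policy S A H, 0 ≤ tvDist (θs.law π) (θ.law π) :=
    fun π => Finset.sum_nonneg fun _ _ => abs_nonneg _
  obtain ⟨m₀, _⟩ := exists_apply_ne_zero θs.w
  have hM : 0 < M := m₀.pos
  obtain ⟨s₀, _⟩ := exists_apply_ne_zero (θs.T m₀ none)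
  have hS : 0 < Fintype.card S := Fintype.card_pos_iff.2 ⟨s₀⟩
  obtain ⟨Cand, hC1, hC2, hC3⟩ := exists_cover_of_not_doublesCoverage θs ⟨_, hΨ⟩ hπ
  obtain ⟨f, hf⟩ := exists_scheduleQuery (S := S) (A := A) (H := H) (d := d) (by omega) (by omega)
  set C : ℝ := if Fintype.card S = 1 then 1 else 2 with hC
  have hC0 : 0 < C := by rw [hC]; split_ifs <;> norm_num
  have hA1 : (1 : ℝ) ≤ Fintype.card A := by exact_mod_cast Fintype.card_pos (α := A)
  have hM1 : (1 : ℝ) ≤ M := by exact_mod_cast hM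
  have hH3 : (3 : ℝ) ≤ H := by exact_mod_cast (by omega : 3 ≤ H)
  have hS1 : (1 : ℝ) ≤ Fintype.card S := by exact_mod_cast hS
  have hCS : (Fintype.card S : ℝ) = 1 ∧ C = 1 ∨ 2 ≤ (Fintype.card S : ℝ) ∧ C = 2 := by
    by_cases h : Fintype.card S = 1
    · left; rw [hC, if_pos h, h]; simp
    · right; rw [hC, if_neg h]
      exact ⟨by exact_mod_cast (by omega : 2 ≤ Fintype.card S), rfl⟩
  have hC1' : 1 ≤ C := by rcases hCS with h | h <;> rw [h.2]; norm_num
  have hle := tvDist_le_sum_schedules (by omega) hd hM θs θ π hC1 hC0.le hC3 f hf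
  have hspec : ∀ l ∈ schedules Cand d H 0, l.length ≤ d ∧ (∀ e ∈ l, e.1 < H ∧ e.2.2 ∈ Ψ) ∧
      l.Pairwise (fun e e' => e.1 < e'.1) ∧
      ∃ h, f l = (scheduleTuple d l, scheduleSwitching l h) := by
    intro l hl
    obtain ⟨h2, h3, h4, h5⟩ := mem_schedules hC1 d H 0 l hl
    have h3' : ∀ e ∈ l, e.1 < H ∧ e.2.2 ∈ Ψ := fun e he => by simpa using (h3 e he).2
    exact ⟨h2, h3', h4, hf l (scheduleTimes_spec h4 (fun e he => (h3' e he).1) h2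
      (h5 (by omega) (by omega)))⟩
  have h0 := (htv π).trans hle
  refine (pow_le_pow_left₀ (htv π) hle 2).trans ((sum_mul_le_of_unif
    (schedules Cand d H 0) _ _ (fun l _ => scheduleWeight_nonneg hC0.le (by positivity) l)
    (fun l => ∀ e ∈ l, e.2.2 = unifPolicy) (x := tvDist (θs.law unifPolicy) (θ.law unifPolicy))
    (W := (H * (C * (Fintype.card A + 1))) ^ d)
    (V := (H * (M * Fintype.card S ^ 2 * (C ^ 2 * (Fintype.card A ^ 2 + 1)))) ^ d)
    ?_ ?_ ?_ ?_ h0 (htv _)).trans (mul_le_mul_of_nonneg_right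
      (schedule_constants_le (by omega) hH3 hM1 hA1 hCS) (add_nonneg (sq_nonneg _)
        (Finset.sum_nonneg fun _ _ => sq_nonneg _))))
  · intro l hl hu
    obtain ⟨_, _, _, h, hfl⟩ := hspec l hl
    rw [queryPolicy_eq_unifPolicy]
    intro i
    rw [hfl]
    simp only [scheduleTuple]
    cases hi : l[i.1]? with
    | none => rfl
    | some e => exact hu e (List.mem_of_getElem? hi)
  · refine (Finset.sum_congr rfl fun l _ =>
      (prod_ite_eq_ite_forall C _ (fun ψ : Policy S A H => ψ = unifPolicy) l).symm).trans_le ?_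
    refine sum_schedules_prod_le Cand
      (fun b ψ => if ψ = unifPolicy then C * (if b = true then (Fintype.card A : ℝ) else 1) else 0)
      ?_ ?_ ?_ d H 0 le_rfl
    · intro b ψ
      split_ifs <;> positivity
    · intro p q q'
      have h1 : ∀ (s : Finset (Policy S A H)) (x : ℝ), 0 ≤ x →
          ∑ ψ ∈ s, (if ψ = unifPolicy then x else 0) ≤ x := by
        intro s x hx
        rw [Finset.sum_ite_eq']
        split_ifs
        exacts [le_rfl, hx]
      have h2 := h1 (Cand p q) (C * Fintype.card A) (by positivity)
      have h3 := h1 (Cand p q') (C * 1) (by positivity)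
      simp only [if_true, Bool.false_eq_true, if_false]
      linarith
    -- `H`, `C` and `|A| + 1` are all at least 1.
    · nlinarith [mul_nonneg (sub_nonneg.2 hC1') (sub_nonneg.2 hA1)]
  · simp only [← prod_sq_eq]
    refine sum_schedules_prod_le Cand
      (fun b _ => (C * (if b = true then (Fintype.card A : ℝ) else 1)) ^ 2)
      (fun b ψ => sq_nonneg _) ?_ ?_ d H 0 le_rfl
    · intro p q q'
      have h1 : ∀ p q, ((Cand p q).card : ℝ) ≤ M * Fintype.card S ^ 2 := by
        intro p q
        exact_mod_cast hC2 p q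
      simp only [Finset.sum_const, nsmul_eq_mul, if_true, Bool.false_eq_true, if_false]
      calc _ ≤ (M * Fintype.card S ^ 2 : ℝ) * (C * Fintype.card A) ^ 2 +
            (M * Fintype.card S ^ 2 : ℝ) * (C * 1) ^ 2 :=
            add_le_add (mul_le_mul_of_nonneg_right (h1 p q) (sq_nonneg _))
              (mul_le_mul_of_nonneg_right (h1 p q') (sq_nonneg _))
        _ = _ := by ring
    · have e1 : (1 : ℝ) ≤ M * Fintype.card S ^ 2 := one_le_mul_of_one_le_of_one_le hM1
        (one_le_pow₀ hS1)
      have e2 : (1 : ℝ) ≤ C ^ 2 * (Fintype.card A ^ 2 + 1) :=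
        one_le_mul_of_one_le_of_one_le (one_le_pow₀ hC1') (by nlinarith)
      exact one_le_mul_of_one_le_of_one_le (by linarith)
        (one_le_mul_of_one_le_of_one_le e1 e2)
  · have hinj : ∀ l ∈ (schedules Cand d H 0).filter fun l => ¬ ∀ e ∈ l, e.2.2 = unifPolicy,
        ∀ l' ∈ (schedules Cand d H 0).filter fun l => ¬ ∀ e ∈ l, e.2.2 = unifPolicy,
        f l = f l' → l = l' := by
      intro l hl l' hl' he
      obtain ⟨h1, h2, h3, h4, h5⟩ := hspec l (Finset.mem_filter.1 hl).1
      obtain ⟨h1', h2', h3', h4', h5'⟩ := hspec l' (Finset.mem_filter.1 hl').1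
      rw [h5, h5', Prod.mk.injEq] at he
      exact scheduleQuery_injective h3 h3' (fun e he => (h2 e he).1) (fun e he => (h2' e he).1) h1
        h4 h4' he.1 he.2
    rw [← Finset.sum_image (f := fun q => tvDist (θs.law (queryPolicy q))
      (θ.law (queryPolicy q)) ^ 2) hinj]
    refine Finset.sum_le_sum_of_subset_of_nonneg ?_ fun _ _ _ => sq_nonneg _
    intro q hq
    obtain ⟨l, hl, rfl⟩ := Finset.mem_image.1 hq
    obtain ⟨hl, hne⟩ := Finset.mem_filter.1 hl
    obtain ⟨h1, h2, h3, h4, h5⟩ := hspec l hl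
    simp only [Finset.mem_product, Finset.mem_filter, Fintype.mem_piFinset, Finset.mem_univ,
      and_true, h5]
    constructor
    · intro i
      simp only [scheduleTuple]
      cases hi : l[i.1]? with
      | none => exact hΨ
      | some e => exact (h2 e (List.mem_of_getElem? hi)).2
    · push Not at hne
      obtain ⟨e, he, hne⟩ := hne
      obtain ⟨i, hi, rfl⟩ := List.getElem_of_mem he
      refine ⟨⟨i, by omega⟩, ?_⟩
      simpa [scheduleTuple, hi] using hne

end Coverage

/-! ### Means with respect to discrete laws -/

section Mean

variable {α γ : Type*}

/-- The mean of a nonnegative function. -/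
noncomputable def pmfMean (p : PMF α) (f : α → ℝ≥0∞) : ℝ≥0∞ := ∑' x, p x * f x

theorem pmfMean_mono {p : PMF α} {f g : α → ℝ≥0∞} (h : ∀ x ∈ p.support, f x ≤ g x) :
    pmfMean p f ≤ pmfMean p g := by
  refine ENNReal.tsum_le_tsum fun x => ?_
  by_cases hx : p x = 0
  · simp [hx]
  · gcongr
    exact h x ((p.mem_support_iff x).2 hx)

theorem pmfMean_const (p : PMF α) (b : ℝ≥0∞) : pmfMean p (fun _ => b) = b := by
  rw [pmfMean, ENNReal.tsum_mul_right, p.tsum_coe, one_mul]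

theorem pmfMean_le {p : PMF α} {f : α → ℝ≥0∞} {b : ℝ≥0∞} (h : ∀ x ∈ p.support, f x ≤ b) :
    pmfMean p f ≤ b :=
  (pmfMean_mono h).trans_eq (pmfMean_const p b)

theorem pmfMean_mul_left (p : PMF α) (b : ℝ≥0∞) (f : α → ℝ≥0∞) :
    pmfMean p (fun x => b * f x) = b * pmfMean p f := by
  simp only [pmfMean, ← ENNReal.tsum_mul_left, mul_left_comm]

theorem pmfMean_sum {ι : Type*} (p : PMF α) (s : Finset ι) (f : ι → α → ℝ≥0∞) :
    pmfMean p (fun x => ∑ i ∈ s, f i x) = ∑ i ∈ s, pmfMean p (f i) := by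
  simp only [pmfMean, Finset.mul_sum]
  exact Summable.tsum_finsetSum fun _ _ => ENNReal.summable

theorem pmfMean_pure (x : α) (f : α → ℝ≥0∞) : pmfMean (PMF.pure x) f = f x := by
  classical
  rw [pmfMean, tsum_eq_single x]
  · simp
  · intro y hy
    simp [PMF.pure_apply, hy]

theorem pmfMean_bind (p : PMF α) (g : α → PMF γ) (f : γ → ℝ≥0∞) :
    pmfMean (p.bind g) f = pmfMean p fun x => pmfMean (g x) f := by
  simp only [pmfMean, PMF.bind_apply, ← ENNReal.tsum_mul_right, ← ENNReal.tsum_mul_left]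
  rw [ENNReal.tsum_comm]
  simp only [mul_assoc]

theorem pmfMean_map (p : PMF α) (g : α → γ) (f : γ → ℝ≥0∞) :
    pmfMean (p.map g) f = pmfMean p fun x => f (g x) := by
  rw [PMF.map, pmfMean_bind]
  simp only [Function.comp_apply, pmfMean_pure]

/-- Markov's inequality, in a form without complements or subtraction. -/
theorem one_le_toOuterMeasure_add_pmfMean (p : PMF α) (s : Set α) {f : α → ℝ≥0∞}
    (h : ∀ x ∉ s, 1 ≤ f x) : 1 ≤ p.toOuterMeasure s + pmfMean p f := by
  classical
  rw [PMF.toOuterMeasure_apply, pmfMean, ← ENNReal.tsum_add, ← p.tsum_coe]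
  refine ENNReal.tsum_le_tsum fun x => ?_
  by_cases hx : x ∈ s
  · simp [hx]
  · simp only [Set.indicator_of_notMem hx, zero_add]
    exact le_mul_of_one_le_right' (h x hx)

end Mean

/-! ### Hellinger affinity and likelihood ratios -/

section Likelihood

variable {X : Type*} [Fintype X]

/-- The Bhattacharyya coefficient. -/
noncomputable def affinity (p q : PMF X) : ℝ := ∑ x, √(p x).toReal * √(q x).toReal

/-- Factor |p - q| = |√p - √q| (√p + √q) and apply Cauchy–Schwarz. -/
theorem tvDist_sq_le_affinity (p q : PMF X) : tvDist p q ^ 2 ≤ 8 * (1 - affinity p q) := by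
  have hp := sum_toReal_pmf p
  have hq := sum_toReal_pmf q
  have e : ∀ x : X, |(p x).toReal - (q x).toReal| =
      |√(p x).toReal - √(q x).toReal| * (√(p x).toReal + √(q x).toReal) := by
    intro x
    have h0 := abs_of_nonneg (add_nonneg (Real.sqrt_nonneg (p x).toReal)
      (Real.sqrt_nonneg (q x).toReal))
    rw [← h0, ← abs_mul, mul_comm, ← sq_sub_sq, Real.sq_sqrt ENNReal.toReal_nonneg,
      Real.sq_sqrt ENNReal.toReal_nonneg]
  have h := Finset.sum_mul_sq_le_sq_mul_sq (Finset.univ : Finset X)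
    (fun x => |√(p x).toReal - √(q x).toReal|) (fun x => √(p x).toReal + √(q x).toReal)
  have h1 : ∑ x, |√(p x).toReal - √(q x).toReal| ^ 2 = 2 - 2 * affinity p q := by
    have : ∀ x : X, |√(p x).toReal - √(q x).toReal| ^ 2 =
        (p x).toReal + (q x).toReal - 2 * (√(p x).toReal * √(q x).toReal) := by
      intro x
      rw [sq_abs, sub_sq, Real.sq_sqrt ENNReal.toReal_nonneg, Real.sq_sqrt ENNReal.toReal_nonneg]
      ring
    simp only [this, Finset.sum_sub_distrib, Finset.sum_add_distrib, ← Finset.mul_sum, hp, hq,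
      affinity]
    norm_num
  have h2 : ∑ x, (√(p x).toReal + √(q x).toReal) ^ 2 = 2 + 2 * affinity p q := by
    have : ∀ x : X, (√(p x).toReal + √(q x).toReal) ^ 2 =
        (p x).toReal + (q x).toReal + 2 * (√(p x).toReal * √(q x).toReal) := by
      intro x
      rw [add_sq, Real.sq_sqrt ENNReal.toReal_nonneg, Real.sq_sqrt ENNReal.toReal_nonneg]
      ring
    simp only [this, Finset.sum_add_distrib, ← Finset.mul_sum, hp, hq, affinity]
    norm_num
  simp only [tvDist, e]
  rw [h1, h2] at h
  -- With affinity a, (2 - 2a)(2 + 2a) = 8(1 - a) - 4(1 - a)².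
  nlinarith [sq_nonneg (1 - affinity p q)]

/-- The square root of the likelihood ratio of `q` to `p`, normalized under `p`. -/
noncomputable def sqrtRatio (p q : PMF X) (x : X) : ℝ :=
  √(q x).toReal / √(p x).toReal / affinity p q

theorem affinity_nonneg (p q : PMF X) : 0 ≤ affinity p q :=
  Finset.sum_nonneg fun _ _ => mul_nonneg (Real.sqrt_nonneg _) (Real.sqrt_nonneg _)

theorem sqrtRatio_nonneg (p q : PMF X) (x : X) : 0 ≤ sqrtRatio p q x :=
  div_nonneg (div_nonneg (Real.sqrt_nonneg _) (Real.sqrt_nonneg _)) (affinity_nonneg p q)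

theorem pmfMean_sqrtRatio_le (p q : PMF X) :
    pmfMean p (fun x => ENNReal.ofReal (sqrtRatio p q x)) ≤ 1 := by
  have h : ∀ x, p x * ENNReal.ofReal (sqrtRatio p q x) =
      ENNReal.ofReal ((p x).toReal * sqrtRatio p q x) := fun x => by
    rw [ENNReal.ofReal_mul ENNReal.toReal_nonneg, ENNReal.ofReal_toReal (p.apply_ne_top x)]
  rw [pmfMean, tsum_fintype]
  simp only [h]
  rw [← ENNReal.ofReal_sum_of_nonneg fun x _ =>
    mul_nonneg ENNReal.toReal_nonneg (sqrtRatio_nonneg p q x), ← ENNReal.ofReal_one]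
  refine ENNReal.ofReal_le_ofReal ?_
  have e : ∀ x, (p x).toReal * sqrtRatio p q x =
      √(p x).toReal * √(q x).toReal / affinity p q := by
    intro x
    rw [sqrtRatio, ← mul_div_assoc, ← mul_div_assoc]
    congr 1
    rcases (Real.sqrt_nonneg (p x).toReal).eq_or_lt with h0 | h0
    · rw [← h0]; simp
    · rw [div_eq_iff h0.ne']
      nth_rewrite 1 [← Real.mul_self_sqrt (ENNReal.toReal_nonneg (a := p x))]
      ring
  simp only [e, ← Finset.sum_div]
  -- For mutually singular laws the affinity is 0 and so is the quotient; otherwise the mean is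
  -- exactly 1.
  exact div_self_le_one _

theorem sqrtRatio_pos {p q : PMF X} {x : X} (hp : p x ≠ 0) (hq : q x ≠ 0) :
    0 < sqrtRatio p q x := by
  have hp' := ENNReal.toReal_pos hp (p.apply_ne_top x)
  have hq' := ENNReal.toReal_pos hq (q.apply_ne_top x)
  refine div_pos (by positivity) (lt_of_lt_of_le (by positivity : 0 < √(p x).toReal * √(q x).toReal)
    (Finset.single_le_sum (f := fun x => √(p x).toReal * √(q x).toReal)
      (fun _ _ => mul_nonneg (Real.sqrt_nonneg _) (Real.sqrt_nonneg _)) (Finset.mem_univ x)))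

/-- The bracket on the right equals the negative logarithm of the affinity a, and -log a ≥ 1 - a. -/
theorem tvDist_sq_le_log {p q : PMF X} {x : X} (hp : p x ≠ 0) (hq : q x ≠ 0) :
    tvDist p q ^ 2 ≤ 8 * (Real.log (sqrtRatio p q x) -
      (Real.log (q x).toReal - Real.log (p x).toReal) / 2) := by
  have hp' := ENNReal.toReal_pos hp (p.apply_ne_top x)
  have hq' := ENNReal.toReal_pos hq (q.apply_ne_top x)
  have ha : 0 < affinity p q := by
    refine (affinity_nonneg p q).lt_of_ne fun h => ?_
    have := sqrtRatio_pos hp hq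
    simp [sqrtRatio, ← h] at this
  have h1 := Real.log_le_sub_one_of_pos ha
  have h2 := tvDist_sq_le_affinity p q
  rw [sqrtRatio, Real.log_div (by positivity) ha.ne', Real.log_div (by positivity) (by positivity),
    Real.log_sqrt hq'.le, Real.log_sqrt hp'.le]
  linarith

end Likelihood

/-! ### Likelihood ratios of datasets and the confidence set -/

section Data

variable {S A R : Type*} [Fintype S] [Fintype A] [Fintype R] {M H : ℕ}

/-- The normalized square root of the likelihood ratio of a dataset. -/
noncomputable def dataRatio (θs θ : LMDP S A R M) (D : Dataset S A R H) : ℝ :=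
  (D.map fun p => sqrtRatio (θs.law p.1) (θ.law p.1) p.2).prod

theorem dataRatio_nonneg (θs θ : LMDP S A R M) (D : Dataset S A R H) : 0 ≤ dataRatio θs θ D := by
  refine List.prod_nonneg fun x hx => ?_
  obtain ⟨p, _, rfl⟩ := List.mem_map.1 hx
  exact sqrtRatio_nonneg _ _ _

/-- The episodes of a fixed list of policies are independent, so the mean of the product is bounded
one factor at a time. -/
theorem pmfMean_dataRatio_le (θs θ : LMDP S A R M) : ∀ l : List (Policy S A H),
    pmfMean (execute θs l) (fun D => ENNReal.ofReal (dataRatio θs θ D)) ≤ 1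
  | [] => by
    rw [execute, pmfMean_pure]
    simp [dataRatio]
  | π :: l => by
    rw [execute, pmfMean_bind]
    refine (pmfMean_mono fun x _ => ?_).trans (pmfMean_sqrtRatio_le (θs.law π) (θ.law π))
    rw [pmfMean_map]
    have h : ∀ D : Dataset S A R H, ENNReal.ofReal (dataRatio θs θ ((π, x) :: D)) =
        ENNReal.ofReal (sqrtRatio (θs.law π) (θ.law π) x) *
          ENNReal.ofReal (dataRatio θs θ D) := fun D => by
      rw [← ENNReal.ofReal_mul (sqrtRatio_nonneg _ _ _)]
      rfl
    simp only [h, pmfMean_mul_left]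
    exact mul_le_of_le_one_right' (pmfMean_dataRatio_le θs θ l)

theorem mem_support_execute {θs : LMDP S A R M} : ∀ {l : List (Policy S A H)}
    {D : Dataset S A R H}, D ∈ (execute θs l).support →
      D.map Prod.fst = l ∧ ∀ p ∈ D, θs.law p.1 p.2 ≠ 0
  | [], D, hD => by
    rw [execute, PMF.mem_support_pure_iff] at hD
    simp [hD]
  | π :: l, D, hD => by
    rw [execute, PMF.mem_support_bind_iff] at hD
    obtain ⟨x, hx, hD⟩ := hD
    obtain ⟨D', hD', rfl⟩ := (PMF.mem_support_map_iff _ _ _).1 hD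
    obtain ⟨h1, h2⟩ := mem_support_execute hD'
    refine ⟨by simp [h1], fun p hp => ?_⟩
    rcases List.mem_cons.1 hp with rfl | hp
    exacts [(PMF.mem_support_iff _ _).1 hx, h2 p hp]

theorem LMDP.logLik_eq (θ : LMDP S A R M) : ∀ {D : Dataset S A R H},
    (∀ p ∈ D, θ.law p.1 p.2 ≠ 0) →
      θ.logLik D = (((D.map fun p => Real.log (θ.law p.1 p.2).toReal).sum : ℝ) : EReal)
  | [], _ => by simp [LMDP.logLik]
  | p :: D, h => by
    have h1 := LMDP.logLik_eq θ (D := D) fun q hq => h q (List.mem_cons_of_mem _ hq)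
    have h2 := h p List.mem_cons_self
    rw [LMDP.logLik] at h1 ⊢
    rw [List.map_cons, List.sum_cons, h1, List.map_cons, List.sum_cons, EReal.coe_add,
      ENNReal.log_pos_real h2 (PMF.apply_ne_top _ _)]

theorem LMDP.logLik_eq_bot (θ : LMDP S A R M) : ∀ {D : Dataset S A R H},
    (∃ p ∈ D, θ.law p.1 p.2 = 0) → θ.logLik D = ⊥
  | [], h => by simp at h
  | p :: D, ⟨q, hq, h⟩ => by
    rw [LMDP.logLik, List.map_cons, List.sum_cons]
    rcases List.mem_cons.1 hq with rfl | hq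
    · rw [h, ENNReal.log_zero, EReal.bot_add]
    · have h1 := LMDP.logLik_eq_bot θ (D := D) ⟨q, hq, h⟩
      rw [LMDP.logLik] at h1
      rw [h1, EReal.add_bot]

theorem sum_tvDist_sq_le_log (θs θ : LMDP S A R M) : ∀ {D : Dataset S A R H},
    (∀ p ∈ D, θs.law p.1 p.2 ≠ 0) → (∀ p ∈ D, θ.law p.1 p.2 ≠ 0) →
    0 < dataRatio θs θ D ∧ (D.map fun p => tvDist (θs.law p.1) (θ.law p.1) ^ 2).sum ≤
      8 * (Real.log (dataRatio θs θ D) - ((D.map fun p => Real.log (θ.law p.1 p.2).toReal).sum -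
        (D.map fun p => Real.log (θs.law p.1 p.2).toReal).sum) / 2)
  | [], _, _ => by simp [dataRatio]
  | p :: D, hs, h => by
    obtain ⟨h1, h2⟩ := sum_tvDist_sq_le_log θs θ (D := D)
      (fun q hq => hs q (List.mem_cons_of_mem _ hq)) fun q hq => h q (List.mem_cons_of_mem _ hq)
    have h3 := sqrtRatio_pos (hs p List.mem_cons_self) (h p List.mem_cons_self)
    have h4 := tvDist_sq_le_log (hs p List.mem_cons_self) (h p List.mem_cons_self)
    have h5 : dataRatio θs θ (p :: D) =
        sqrtRatio (θs.law p.1) (θ.law p.1) p.2 * dataRatio θs θ D := rfl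
    rw [h5]
    refine ⟨mul_pos h3 h1, ?_⟩
    rw [Real.log_mul h3.ne' h1.ne']
    simp only [List.map_cons, List.sum_cons]
    linarith

theorem sum_tvDist_sq_le_of_mem_confSet {Θ : Finset (LMDP S A R M)} {θs θ : LMDP S A R M}
    (hθs : θs ∈ Θ) {β : ℝ} {D : Dataset S A R H} (hD : ∀ p ∈ D, θs.law p.1 p.2 ≠ 0)
    (hθ : θ ∈ confSet Θ β D) (hr : dataRatio θs θ D < Real.exp β) :
    (D.map fun p => tvDist (θs.law p.1) (θ.law p.1) ^ 2).sum ≤ 12 * β := by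
  have h1 : θs.logLik D - (β : EReal) ≤ θ.logLik D :=
    (EReal.sub_le_sub (Finset.le_sup (f := fun θ' : LMDP S A R M => θ'.logLik D) hθs) le_rfl).trans
      hθ.2
  rw [θs.logLik_eq hD, ← EReal.coe_sub] at h1
  -- The true log-likelihood is finite, which excludes models giving some observed trajectory
  -- probability zero.
  have h2 : ∀ p ∈ D, θ.law p.1 p.2 ≠ 0 := by
    intro p hp h
    rw [θ.logLik_eq_bot ⟨p, hp, h⟩] at h1
    exact absurd h1 (not_le.2 (EReal.bot_lt_coe _))
  rw [θ.logLik_eq h2, EReal.coe_le_coe_iff] at h1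
  obtain ⟨h3, h4⟩ := sum_tvDist_sq_le_log θs θ hD h2
  have h5 := (Real.log_lt_iff_lt_exp h3).2 hr
  -- The ratio contributes less than β and the confidence set at most β/2; 8(β + β/2) = 12β.
  linarith

end Data

/-! ### The run of the algorithm -/

section Run

variable {S A R : Type*} [Fintype S] [Fintype A] [Fintype R] [Nonempty A] {M H d n : ℕ}

open Classical in
/-- The queries for `Ψ` that are not uniform throughout. -/
noncomputable def properQueries (d : ℕ) (Ψ : Finset (Policy S A H)) :
    Finset ((Fin d → Policy S A H) × Switching H d) :=
  (Fintype.piFinset fun _ : Fin d => Ψ).filter (fun ψ => ∃ i, ψ i ≠ unifPolicy) ×ˢ Finset.univ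

/-- The data contain `n` episodes of the uniform policy and of every query policy, and they are
possible in the true model. -/
structure IsRecorded (θs : LMDP S A R M) (d n : ℕ) (σ : RunState S A R H) : Prop where
  law_ne_zero : ∀ p ∈ σ.data, θs.law p.1 p.2 ≠ 0
  le_sum : ∀ g : Policy S A H → ℝ, (∀ π, 0 ≤ g π) →
    n * (g unifPolicy + ∑ q ∈ properQueries d (testSet σ.chosen), g (queryPolicy q)) ≤
      (σ.data.map fun p => g p.1).sum

theorem properQueries_nil : properQueries d (testSet ([] : List (Policy S A H))) = ∅ := by
  classical
  ext q
  simp only [properQueries, testSet, List.toFinset_nil, Finset.mem_product, Finset.mem_filter,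
    Fintype.mem_piFinset, Finset.mem_univ, and_true, Finset.notMem_empty, iff_false]
  rintro ⟨h1, i, h2⟩
  exact h2 (by simpa using h1 i)

-- A query that is new for the enlarged test set uses the new policy, so it is executed in the
-- current iteration.
open Classical in
theorem properQueries_append_subset (l : List (Policy S A H)) (π : Policy S A H) :
    properQueries d (testSet (l ++ [π])) ⊆
      properQueries d (testSet l) ∪ queries d (testSet (l ++ [π])) π := by
  intro q hq
  simp only [properQueries, queries, Finset.mem_union, Finset.mem_product, Finset.mem_filter,
    Fintype.mem_piFinset, Finset.mem_univ, and_true] at hq ⊢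
  by_cases h : ∃ i, q.1 i = π
  · exact Or.inr ⟨hq.1, h⟩
  · push Not at h
    refine Or.inl ⟨fun i => ?_, hq.2⟩
    have h1 := hq.1 i
    simp only [testSet, Finset.mem_insert, List.mem_toFinset, List.mem_append,
      List.mem_singleton] at h1 ⊢
    rcases h1 with h1 | h1 | h1
    exacts [Or.inl h1, Or.inr h1, absurd h1 (h i)]

theorem sum_map_plan (g : Policy S A H → ℝ) (Ψ : Finset (Policy S A H)) (π : Policy S A H) :
    ((plan d n Ψ π).map g).sum = n * ∑ q ∈ queries d Ψ π, g (queryPolicy q) := by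
  have h : ∀ l : List ((Fin d → Policy S A H) × Switching H d),
      ((l.flatMap fun q => List.replicate n (queryPolicy q)).map g).sum =
        n * (l.map fun q => g (queryPolicy q)).sum := by
    intro l
    induction l with
    | nil => simp
    | cons q l ih => simp [ih, mul_add]
  rw [← Finset.sum_map_toList]
  exact h _

theorem IsRecorded.init {θs : LMDP S A R M} {D : Dataset S A R H}
    (hD : D ∈ (execute θs (List.replicate n unifPolicy)).support) : IsRecorded θs d n ⟨[], D⟩ := by
  obtain ⟨h1, h2⟩ := mem_support_execute hD
  refine ⟨h2, fun g _ => ?_⟩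
  rw [properQueries_nil, Finset.sum_empty, add_zero]
  have : (D.map fun p => g p.1) = (D.map Prod.fst).map g := by simp
  simp [this, h1]

theorem IsRecorded.step {θs : LMDP S A R M} {σ : RunState S A R H} (hσ : IsRecorded θs d n σ)
    {π : Policy S A H} {D : Dataset S A R H}
    (hD : D ∈ (execute θs (plan d n (testSet (σ.chosen ++ [π])) π)).support) :
    IsRecorded θs d n ⟨σ.chosen ++ [π], σ.data ++ D⟩ := by
  classical
  obtain ⟨h1, h2⟩ := mem_support_execute hD
  refine ⟨fun p hp => ?_, fun g hg => ?_⟩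
  · rcases List.mem_append.1 hp with hp | hp
    exacts [hσ.law_ne_zero p hp, h2 p hp]
  · have h3 : (D.map fun p => g p.1) = (D.map Prod.fst).map g := by simp
    rw [List.map_append, List.sum_append, h3, h1, sum_map_plan]
    have h4 := hσ.le_sum g hg
    have h5 : ∑ q ∈ properQueries d (testSet (σ.chosen ++ [π])), g (queryPolicy q) ≤
        ∑ q ∈ properQueries d (testSet σ.chosen), g (queryPolicy q) +
        ∑ q ∈ queries d (testSet (σ.chosen ++ [π])) π, g (queryPolicy q) := by
      refine (Finset.sum_le_sum_of_subset_of_nonneg (properQueries_append_subset _ _)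
        fun q _ _ => hg _).trans ?_
      rw [← Finset.sum_union_inter]
      exact le_add_of_nonneg_right (Finset.sum_nonneg fun q _ => hg _)
    have h6 := mul_le_mul_of_nonneg_left h5 (Nat.cast_nonneg n : (0 : ℝ) ≤ n)
    linarith

theorem tvDist_triangle {X : Type*} [Fintype X] (p q r : PMF X) :
    tvDist p r ≤ tvDist q p + tvDist q r := by
  rw [tvDist_comm q p, tvDist, tvDist, tvDist, ← Finset.sum_add_distrib]
  exact Finset.sum_le_sum fun x _ => abs_sub_le _ _ _

theorem doublesCoverage_of_isDistinguishing (hH : 2 * M < H) (hd : d = 2 * M - 1)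
    {Θ : Finset (LMDP S A R M)} {θs : LMDP S A R M} (hθs : θs ∈ Θ) {ε β : ℝ} (hε : 0 < ε)
    (hβ : 0 < β)
    (hn : 3 * β * M ^ 2 * (8 * H ^ 2) ^ d * (M * Fintype.card S ^ 2 * Fintype.card A ^ 2) ^ d
      / ε ^ 2 ≤ (n : ℝ))
    {σ : RunState S A R H} (hσ : IsRecorded θs d n σ)
    (hr : ∀ θ ∈ Θ, dataRatio θs θ σ.data < Real.exp β) {π : Policy S A H}
    (hπ : IsDistinguishing Θ β ε σ π) : DoublesCoverage θs (testSet σ.chosen) π := by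
  classical
  by_contra hcon
  -- Two models more than 4ε apart cannot both be within 2ε of the true one.
  have hfar : ∃ θ ∈ confSet Θ β σ.data, 2 * ε < tvDist (θs.law π) (θ.law π) := by
    obtain ⟨θ₁, h₁, θ₂, h₂, h⟩ := hπ
    have := tvDist_triangle (θ₁.law π) (θs.law π) (θ₂.law π)
    by_contra! hc
    linarith [hc θ₁ h₁, hc θ₂ h₂]
  obtain ⟨θ, hθ, hlt⟩ := hfar
  have h1 := tvDist_sq_le_of_not_doublesCoverage hH hd θs θ
    (Finset.mem_insert_self _ _ : unifPolicy ∈ testSet σ.chosen) hcon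
  have h2 := sum_tvDist_sq_le_of_mem_confSet hθs hσ.law_ne_zero hθ (hr θ hθ.1)
  have h3 := hσ.le_sum (fun π => tvDist (θs.law π) (θ.law π) ^ 2) fun _ => sq_nonneg _
  simp only [properQueries] at h3
  set Y := tvDist (θs.law (unifPolicy : Policy S A H)) (θ.law unifPolicy) ^ 2 +
    ∑ q ∈ (Fintype.piFinset fun _ : Fin d => testSet σ.chosen).filter
      (fun ψ => ∃ i, ψ i ≠ unifPolicy) ×ˢ (Finset.univ : Finset (Switching H d)),
        tvDist (θs.law (queryPolicy q)) (θ.law (queryPolicy q)) ^ 2 with hY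
  obtain ⟨m₀, _⟩ := exists_apply_ne_zero θs.w
  have hM : 0 < M := m₀.pos
  obtain ⟨s₀, _⟩ := exists_apply_ne_zero (θs.T m₀ none)
  have hS : 0 < Fintype.card S := Fintype.card_pos_iff.2 ⟨s₀⟩
  have hA : 0 < Fintype.card A := Fintype.card_pos
  have hH0 : 0 < H := by omega
  set B : ℝ := (8 * (H : ℝ) ^ 2) ^ d * (M * Fintype.card S ^ 2 * Fintype.card A ^ 2) ^ d with hB
  have hB0 : 0 < B := by positivity
  have hM1 : (1 : ℝ) ≤ (M : ℝ) ^ 2 := one_le_pow₀ (by exact_mod_cast hM)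
  have h4 : 3 * β * M ^ 2 * B ≤ n * ε ^ 2 := by
    rw [div_le_iff₀ (by positivity)] at hn
    linarith
  have h5 : 3 * β * B ≤ 3 * β * M ^ 2 * B := by
    have := mul_le_mul_of_nonneg_left hM1 (by positivity : 0 ≤ 3 * β * B)
    linarith
  have hn0 : (0 : ℝ) < n := by
    have : 0 < (n : ℝ) * ε ^ 2 := lt_of_lt_of_le (by positivity) (h5.trans h4)
    exact pos_of_mul_pos_left this (sq_nonneg ε)
  have h6 : (2 * ε) ^ 2 < tvDist (θs.law π) (θ.law π) ^ 2 :=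
    pow_lt_pow_left₀ hlt (by positivity) two_ne_zero
  have h7 : (n : ℝ) * (2 * ε) ^ 2 < n * (B * Y) := mul_lt_mul_of_pos_left (h6.trans_le h1) hn0
  have h8 : B * (n * Y) ≤ B * (12 * β) := mul_le_mul_of_nonneg_left (h3.trans h2) hB0.le
  -- Now 4ε²n < B n Y ≤ 12βB, whereas `h5` and `h4` give 3βB ≤ nε².
  nlinarith

/-- Every policy chosen so far doubled the coverage of the test policies before it. -/
def AllDouble (θs : LMDP S A R M) (σ : RunState S A R H) : Prop :=
  ∀ (k : ℕ) (hk : k < σ.chosen.length),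
    DoublesCoverage θs (testSet (σ.chosen.take k)) σ.chosen[k]

theorem AllDouble.append {θs : LMDP S A R M} {σ : RunState S A R H} (hσ : AllDouble θs σ)
    {π : Policy S A H} (hπ : DoublesCoverage θs (testSet σ.chosen) π) (D : Dataset S A R H) :
    AllDouble θs ⟨σ.chosen ++ [π], D⟩ := by
  intro k hk
  simp only [List.length_append, List.length_singleton] at hk
  rcases Nat.lt_succ_iff_lt_or_eq.1 hk with h | rfl
  · have := hσ k h
    simp only
    rwa [List.take_append_of_le_length h.le, List.getElem_append_left h]
  · simpa using hπ

open Classical in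
/-- A supermartingale along the run that is one as soon as the coverage fails to double. -/
noncomputable def failurePotential (Θ : Finset (LMDP S A R M)) (θs : LMDP S A R M) (d n : ℕ)
    (β : ℝ) (σ : RunState S A R H) : ℝ≥0∞ :=
  if AllDouble θs σ ∧ IsRecorded θs d n σ then
    min 1 (ENNReal.ofReal (Real.exp (-β)) * ∑ θ ∈ Θ, ENNReal.ofReal (dataRatio θs θ σ.data))
  else 1

theorem failurePotential_le_one (Θ : Finset (LMDP S A R M)) (θs : LMDP S A R M) (β : ℝ)
    (σ : RunState S A R H) : failurePotential Θ θs d n β σ ≤ 1 := by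
  unfold failurePotential
  split_ifs
  exacts [min_le_left _ _, le_rfl]

theorem dataRatio_append (θs θ : LMDP S A R M) (D D' : Dataset S A R H) :
    dataRatio θs θ (D ++ D') = dataRatio θs θ D * dataRatio θs θ D' := by
  simp [dataRatio]

/-- If the weighted sum of ratios is below 1, every ratio is below e^β, so whatever the rule selects
doubles coverage and only the ratio of the new data has to be averaged. In all other cases the
potential is already 1 or the run has stopped. -/
theorem pmfMean_iterate_le (hH : 2 * M < H) (hd : d = 2 * M - 1)
    {Θ : Finset (LMDP S A R M)} {θs : LMDP S A R M} (hθs : θs ∈ Θ) {ε β : ℝ} (hε : 0 < ε)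
    (hβ : 0 < β)
    (hn : 3 * β * M ^ 2 * (8 * H ^ 2) ^ d * (M * Fintype.card S ^ 2 * Fintype.card A ^ 2) ^ d
      / ε ^ 2 ≤ (n : ℝ))
    {sel : RunState S A R H → PMF (Policy S A H)} (hsel : IsSelectionRule Θ β ε sel)
    (σ : RunState S A R H) :
    pmfMean (iterate θs Θ d n β ε sel σ) (failurePotential Θ θs d n β) ≤
      failurePotential Θ θs d n β σ := by
  classical
  have hone : pmfMean (iterate θs Θ d n β ε sel σ) (failurePotential Θ θs d n β) ≤ 1 :=
    pmfMean_le fun _ _ => failurePotential_le_one _ _ _ _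
  by_cases hσ : AllDouble θs σ ∧ IsRecorded θs d n σ
  swap
  · rwa [failurePotential, if_neg hσ]
  by_cases hdist : ∃ π, IsDistinguishing Θ β ε σ π
  swap
  · rw [iterate, if_neg hdist, pmfMean_pure]
  rw [failurePotential, if_pos hσ]
  refine le_min hone ?_
  by_cases hbig : 1 ≤ ENNReal.ofReal (Real.exp (-β)) *
      ∑ θ ∈ Θ, ENNReal.ofReal (dataRatio θs θ σ.data)
  · exact hone.trans hbig
  have hr : ∀ θ ∈ Θ, dataRatio θs θ σ.data < Real.exp β := by
    intro θ hθ
    by_contra! h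
    refine hbig ?_
    calc (1 : ℝ≥0∞) = ENNReal.ofReal (Real.exp (-β)) * ENNReal.ofReal (Real.exp β) := by
          rw [← ENNReal.ofReal_mul (Real.exp_nonneg _), ← Real.exp_add]
          simp
      _ ≤ _ := by
        gcongr
        exact (ENNReal.ofReal_le_ofReal h).trans
          (Finset.single_le_sum (f := fun θ => ENNReal.ofReal (dataRatio θs θ σ.data))
            (fun _ _ => zero_le) hθ)
  rw [iterate, if_pos hdist, pmfMean_bind]
  refine pmfMean_le fun π hπ => ?_
  have hdbl := doublesCoverage_of_isDistinguishing hH hd hθs hε hβ hn hσ.2 hr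
    (hsel σ hdist π hπ)
  rw [pmfMean_map]
  calc _ ≤ pmfMean (execute θs (plan d n (testSet (σ.chosen ++ [π])) π)) fun D =>
        ENNReal.ofReal (Real.exp (-β)) * ∑ θ ∈ Θ,
          ENNReal.ofReal (dataRatio θs θ σ.data) * ENNReal.ofReal (dataRatio θs θ D) := by
        refine pmfMean_mono fun D hD => ?_
        rw [failurePotential, if_pos ⟨hσ.1.append hdbl _, hσ.2.step hD⟩]
        refine (min_le_right _ _).trans_eq ?_
        simp only [dataRatio_append, ENNReal.ofReal_mul (dataRatio_nonneg _ _ _)]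
    _ ≤ _ := by
      simp only [pmfMean_mul_left, pmfMean_sum]
      gcongr with θ hθ
      exact mul_le_of_le_one_right' (pmfMean_dataRatio_le θs θ _)

theorem pmfMean_runLaw_le (hH : 2 * M < H) (hd : d = 2 * M - 1)
    {Θ : Finset (LMDP S A R M)} {θs : LMDP S A R M} (hθs : θs ∈ Θ) {ε β : ℝ} (hε : 0 < ε)
    (hβ : 0 < β)
    (hn : 3 * β * M ^ 2 * (8 * H ^ 2) ^ d * (M * Fintype.card S ^ 2 * Fintype.card A ^ 2) ^ d
      / ε ^ 2 ≤ (n : ℝ))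
    {sel : RunState S A R H → PMF (Policy S A H)} (hsel : IsSelectionRule Θ β ε sel) (N : ℕ) :
    pmfMean (runLaw θs Θ d n β ε sel N) (failurePotential Θ θs d n β) ≤
      ENNReal.ofReal (Real.exp (-β) * Θ.card) := by
  classical
  induction N with
  | zero =>
    rw [runLaw, pmfMean_map]
    calc _ ≤ pmfMean (execute θs (List.replicate n unifPolicy)) fun D =>
          ENNReal.ofReal (Real.exp (-β)) * ∑ θ ∈ Θ, ENNReal.ofReal (dataRatio θs θ D) := by
          refine pmfMean_mono fun D hD => ?_
          rw [failurePotential, if_pos ⟨fun k hk => by simp at hk, IsRecorded.init hD⟩]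
          exact min_le_right _ _
      _ ≤ ENNReal.ofReal (Real.exp (-β)) * ∑ θ ∈ Θ, 1 := by
        simp only [pmfMean_mul_left, pmfMean_sum]
        gcongr with θ hθ
        exact pmfMean_dataRatio_le θs θ _
      _ = _ := by
        rw [ENNReal.ofReal_mul (Real.exp_nonneg _)]
        simp
  | succ N ih =>
    rw [runLaw, pmfMean_bind]
    exact (pmfMean_mono fun σ _ => pmfMean_iterate_le hH hd hθs hε hβ hn hsel σ).trans ih

end Run

/-! ### Conclusion -/

theorem lemma5 {S A R : Type*} [Fintype S] [Fintype A] [Fintype R] [Nonempty A]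
    {M H d : ℕ} (hH : 2 * M < H) (hd : d = 2 * M - 1)
    -- a finite class of models containing the true one
    (Θ : Finset (LMDP S A R M)) (θs : LMDP S A R M) (hθs : θs ∈ Θ)
    -- the inputs of the algorithm
    (K ntest : ℕ) (hK : 1 ≤ K) (ε η β : ℝ) (hε : 0 < ε) (hη : 0 < η)
    (hβ : β = Real.log (K * Θ.card / η))
    (hn : 3 * β * M ^ 2 * (8 * H ^ 2) ^ d * (M * Fintype.card S ^ 2 * Fintype.card A ^ 2) ^ d
      / ε ^ 2 ≤ (ntest : ℝ))
    (sel : RunState S A R H → PMF (Policy S A H)) (hsel : IsSelectionRule Θ β ε sel) :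
    -- the events below decrease with `N`, so this bounds the probability of their intersection
    ∀ N : ℕ, ENNReal.ofReal (1 - η) ≤
      (runLaw θs Θ d ntest β ε sel N).toOuterMeasure
        {σ | ∀ (k : ℕ) (hk : k < σ.chosen.length),
          DoublesCoverage θs (testSet (σ.chosen.take k)) σ.chosen[k]} := by
  intro N
  -- For η ≥ 1 nothing is claimed; η < 1 makes β strictly positive, which the contradiction argument
  -- needs.
  rcases le_or_gt 1 η with h1 | h1
  · rw [ENNReal.ofReal_of_nonpos (by linarith)]
    exact zero_le
  have hcard : (1 : ℝ) ≤ Θ.card := by exact_mod_cast Finset.card_pos.2 ⟨θs, hθs⟩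
  have hK' : (1 : ℝ) ≤ K := by exact_mod_cast hK
  have hKc : 1 ≤ (K : ℝ) * Θ.card := one_le_mul_of_one_le_of_one_le hK' hcard
  have hβ0 : 0 < β := by
    rw [hβ]
    exact Real.log_pos ((one_lt_div hη).2 (h1.trans_le hKc))
  -- The left side equals η/K.
  have hexp : Real.exp (-β) * Θ.card ≤ η := by
    rw [Real.exp_neg, hβ, Real.exp_log (by positivity), inv_div, div_mul_eq_mul_div,
      div_le_iff₀ (by positivity)]
    have := mul_le_mul_of_nonneg_right hK' (by positivity : 0 ≤ η * (Θ.card : ℝ))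
    linarith
  have hmean := (pmfMean_runLaw_le hH hd hθs hε hβ0 hn hsel N).trans
    (ENNReal.ofReal_le_ofReal hexp)
  have hprob := one_le_toOuterMeasure_add_pmfMean (runLaw θs Θ d ntest β ε sel N)
    {σ | AllDouble θs σ} (f := failurePotential Θ θs d ntest β) fun σ hσ => by
      rw [failurePotential, if_neg fun h => hσ h.1]
  rw [ENNReal.ofReal_sub _ hη.le, ENNReal.ofReal_one, tsub_le_iff_right]
  exact hprob.trans (add_le_add le_rfl hmean)
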